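/- **Setting.** Let $K$ be a field and let $q,s\in K\setminus\{0\}$ satisfy $q^as^b\neq 1$ for all $(a,b)\in\mathbb Z^2\setminus\{(0,0)\}$ (for instance $K=\mathbb C(s,q)$ with indeterminates $s,q$). Let $\lambda$ be a partition of $N\ge 1$. All operators act on the right: in a product $AB$ the operator $A$ is applied first. For a vector $u=[u_1,\dots,u_N]$ let $us_i$ be $u$ with the entries $u_i,u_{i+1}$ exchanged. *Tableaux.* A reverse standard tableau (RST) of shape $\lambda$ is a filling $\mathbb T$ of the cells of $\lambda$ with $1,\dots,N$, each used once, strictly decreasing along rows and columns (rows and columns being numbered from the corner cell common to the first row and the first column, so that this cell contains $N$). Let $\mathrm{ROW}_{\mathbb T}[i]$, $\mathrm{COL}_{\mathbb T}[i]$ be the row and column of $i$, and $\mathrm{CT}_{\mathbb T}[i]=\mathrm{COL}_{\mathbb T}[i]-\mathrm{ROW}_{\mathbb T}[i]$. Let $\mathbb T^{(k,\ell)}$ be $\mathbb T$ with the entries $k$ and $\ell$ exchanged. Let $V_\lambda$ be the $K$-space with basis the RST of shape $\lambda$, and for $1\le i<N$ let $T_i$ act on it as follows, with $m=\mathrm{CT}_{\mathbb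 T}[i+1]-\mathrm{CT}_{\mathbb T}[i]$: $\mathbb TT_i=s\mathbb T$ if $i,i+1$ are in the same row; $\mathbb TT_i=-\mathbb T$ if they are in the same column; otherwise $$\mathbb TT_i=\mathbb T^{(i,i+1)}-\frac{1-s}{1-s^m}\mathbb T\quad\text{if }\mathrm{ROW}_{\mathbb T}[i]<\mathrm{ROW}_{\mathbb T}[i+1],$$ $$\mathbb TT_i=\frac{s-1}{1-s^m}\mathbb T+\frac{s(1-s^{m+1})(1-s^{m-1})}{(1-s^m)^2}\mathbb T^{(i,i+1)}\quad\text{if }\mathrm{ROW}_{\mathbb T}[i]>\mathrm{ROW}_{\mathbb T}[i+1].$$ *Operators.* On $\mathcal M_\lambda=K[x_1,\dots,x_N]\otimes V_\lambda$ let $$(p\otimes u)\mathbf T_i=(1-s)\,x_{i+1}\frac{p-p^{s_i}}{x_i-x_{i+1}}\otimes u+p^{s_i}\otimes uT_i ,$$ where $p^{s_i}$ is $p$ with $x_i,x_{i+1}$ exchanged. Let $\mathbf T_i^{-1}=\frac1s(\mathbf T_i+1-s)$ and $\boldsymbol\Phi=\mathbf T_1^{-1}\cdots\mathbf T_{N-1}^{-1}x_N$,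 where $x_N$ denotes multiplication by $x_N$. *Yang--Baxter graph.* Vertices are 4-tuples $(\mathbb T,\zeta,v,\sigma)$ with $\mathbb T$ an RST of shape $\lambda$, $\zeta\in K^N$, $v\in\mathbb N^N$ and $\sigma$ a vector of length $N$ with entries in $\{1,\dots,N\}$. The root is $(\mathbb T_\lambda,[s^{\mathrm{CT}_{\mathbb T_\lambda}[j]}]_{j},0^N,[1,\dots,N])$, where $\mathbb T_\lambda$ is obtained by putting $N,N-1,\dots,1$ into the first column in the order of increasing row number, then into the second column, and so on. From a vertex $(\mathbb T,\zeta,v,\sigma)$ there are the following arrows: - $s_i$, if $v_i<v_{i+1}$, leading to $(\mathbb T,\zeta s_i,vs_i,\sigma s_i)$; - $s_i$, if $v_i=v_{i+1}$, $\sigma_i<\sigma_{i+1}$, $\mathbb T^{(\sigma_i,\sigma_{i+1})}$ is an RST and $\mathrm{CT}_{\mathbb T}[\sigma_i]\ge\mathrm{CT}_{\mathbb T}[\sigma_{i+1}]+2$, leading to $(\mathbb T^{(\sigma_i,\sigma_{i+1})},\zeta s_i,v,\sigma)$; - $\Psi$, leading to $(\mathbb T,\zeta\Psi^q,[v_2,\dots,v_N,v_1+1],[\sigma_2,\dots,\sigma_N,\sigma_1])$,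 where $\zeta\Psi^q=[\zeta_2,\dots,\zeta_N,q\zeta_1]$. To each path from the root attach a polynomial in $\mathcal M_\lambda$: the empty path gives $1\otimes\mathbb T_\lambda$; if a path ending at $(\mathbb T,\zeta,v,\sigma)$ gives $P$, then its extension by $s_i$ gives $P\bigl(\mathbf T_i+\frac{1-s}{1-\zeta_{i+1}/\zeta_i}\bigr)$ and its extension by $\Psi$ gives $P\boldsymbol\Phi$. If there is a path ending at a vertex whose second component is $\zeta$, and all such paths give the same polynomial, then $P_\zeta$ is said to be well defined and denotes this polynomial, the (vector valued, nonsymmetric) Macdonald polynomial. *Spectral vectors.* For $v\in\mathbb N^N$ let $r_v[i]=\#\{j\le i: v_j\ge v_i\}+\#\{j>i: v_j>v_i\}$, and for an RST $\mathbb T$ of shape $\lambda$ let $\zeta_{v,\mathbb T}=[q^{v_i}s^{\mathrm{CT}_{\mathbb T}[r_v[i]]}]_{1\le i\le N}$. For integers $n_1,m_1,n_2,m_2$ write $q^{n_1}s^{m_1}\succ q^{n_2}s^{m_2}$ if $n_1>n_2$, or $n_1=n_2$ and $m_1\le m_2-2$; write $q^{n_1}s^{m_1}\nsim q^{n_2}s^{m_2}$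 if $n_1=n_2$ and $|m_1-m_2|=1$. **Proposition.** Let $v\in\mathbb N^N$, let $\mathbb T$ be an RST of shape $\lambda$, and let $\zeta=\zeta_{v,\mathbb T}$. Then $P_\zeta$ and $P_{\zeta\Psi^q}$ are well defined, and $$P_\zeta\boldsymbol\Phi=P_{\zeta\Psi^q}.$$ Moreover, for every $1\le i<N$ one of $\zeta_{i+1}\succ\zeta_i$, $\zeta_i\succ\zeta_{i+1}$, $\zeta_i\nsim\zeta_{i+1}$ holds; in the first two cases $P_{\zeta s_i}$ is well defined; and $$P_\zeta\left(\mathbf T_i+\frac{(1-s)\zeta_i}{\zeta_i-\zeta_{i+1}}\right)=\begin{cases}P_{\zeta s_i}&\text{if }\zeta_{i+1}\succ\zeta_i,\\[4pt]\dfrac{(\zeta_i-s\zeta_{i+1})(s\zeta_i-\zeta_{i+1})}{(\zeta_i-\zeta_{i+1})^2}\,P_{\zeta s_i}&\text{if }\zeta_i\succ\zeta_{i+1},\\[4pt]0&\text{if }\zeta_i\nsim\zeta_{i+1}.\end{cases}$$ -/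

import Mathlib

open scoped TensorProduct

namespace VVMac

noncomputable section

/-! Throughout, `N = n + 1`; the letters `1, …, N` are the elements of `Fin (n + 1)` (so the
letter `k` is `k - 1`) and the generators `T_1, …, T_{N-1}` are indexed by `Fin n`: the index
`i : Fin n` refers to the neighbouring letters `i.castSucc` and `i.succ`. All operators act on
the right in the mathematics: a product `A B` means that `A` is applied first. -/

/-! ### Reverse standard tableaux -/

/-- Bijective fillings of the diagram `μ`, given by the cell that contains each letter. -/
abbrev Filling (n : ℕ) (μ : YoungDiagram) : Type := Fin (n + 1) ≃ μ.cells

namespace Filling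

variable {n : ℕ} {μ : YoungDiagram}

/-- Row of the letter `a`. -/
def row (f : Filling n μ) (a : Fin (n + 1)) : ℕ := (f a).1.1

/-- Column of the letter `a`. -/
def col (f : Filling n μ) (a : Fin (n + 1)) : ℕ := (f a).1.2

/-- Content of the letter `a`: column minus row. -/
def content (f : Filling n μ) (a : Fin (n + 1)) : ℤ := (f.col a : ℤ) - (f.row a : ℤ)

/-- The filling in which the letters `a` and `b` have been exchanged. -/
def exchange (f : Filling n μ) (a b : Fin (n + 1)) : Filling n μ := (Equiv.swap a b).trans f

/-- Entries strictly decrease along each row and along each column. -/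
def IsRST (f : Filling n μ) : Prop :=
  (∀ a b, f.row a = f.row b → f.col a < f.col b → b < a) ∧
  (∀ a b, f.col a = f.col b → f.row a < f.row b → b < a)

end Filling

/-- Reverse standard tableaux of shape `μ`. -/
def RST (n : ℕ) (μ : YoungDiagram) : Type := {f : Filling n μ // f.IsRST}

variable {K : Type*} [Field K] {n : ℕ} {μ : YoungDiagram}

open Classical in
/-- The tableau with `a` and `b` exchanged if this is a reverse standard tableau
(and the tableau itself otherwise). -/
def RST.exchange (T : RST n μ) (a b : Fin (n + 1)) : RST n μ :=
  if h : (T.1.exchange a b).IsRST then ⟨T.1.exchange a b, h⟩ else T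

/-- Cells `(row, column)` viewed as `(column, row)`, to be ordered lexicographically. -/
def columnOrder : (ℕ × ℕ) ↪ (ℕ ×ₗ ℕ) := ((Equiv.prodComm ℕ ℕ).trans toLex).toEmbedding

/-- The letters in decreasing order put in the cells column by column, each column being filled
in the order of increasing row index. -/
def rootFilling (h : μ.card = n + 1) : Filling n μ :=
  (Fin.revPerm.trans
    ((μ.cells.map columnOrder).orderIsoOfFin ((Finset.card_map _).trans h)).toEquiv).trans
    (Finset.equivMap columnOrder μ.cells).symm

theorem rootFilling_lt (h : μ.card = n + 1) (a b : Fin (n + 1))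
    (hab : columnOrder (rootFilling h a).1 < columnOrder (rootFilling h b).1) : b < a := by
  have key : ∀ c, columnOrder (rootFilling h c).1 =
      (((μ.cells.map columnOrder).orderIsoOfFin ((Finset.card_map _).trans h)) (Fin.rev c)).1 := by
    intro c
    have := congrArg Subtype.val ((Finset.equivMap columnOrder μ.cells).apply_symm_apply
      (((μ.cells.map columnOrder).orderIsoOfFin ((Finset.card_map _).trans h)) (Fin.rev c)))
    exact this
  rw [key, key] at hab
  have h2 := (OrderIso.lt_iff_lt _).1 (Subtype.coe_lt_coe.1 hab)
  exact Fin.rev_lt_rev.1 h2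

theorem rootFilling_isRST (h : μ.card = n + 1) : (rootFilling h).IsRST := by
  refine ⟨fun a b _ hc => rootFilling_lt h a b ?_, fun a b hc hr => rootFilling_lt h a b ?_⟩
  · exact Prod.Lex.toLex_lt_toLex.2 (Or.inl hc)
  · exact Prod.Lex.toLex_lt_toLex.2 (Or.inr ⟨hc, hr⟩)

/-- The root tableau of shape `μ`. -/
def rootRST (h : μ.card = n + 1) : RST n μ := ⟨rootFilling h, rootFilling_isRST h⟩

/-! ### The Hecke module with basis the reverse standard tableaux -/

/-- The image of the basis element `T` under the generator `T_i`. -/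
def tableauImage (s : K) (i : Fin n) (T : RST n μ) : RST n μ →₀ K :=
  let m : ℤ := T.1.content i.succ - T.1.content i.castSucc
  let T' : RST n μ := T.exchange i.castSucc i.succ
  if T.1.row i.castSucc = T.1.row i.succ then s • Finsupp.single T 1
  else if T.1.col i.castSucc = T.1.col i.succ then - Finsupp.single T 1
  else if T.1.row i.castSucc < T.1.row i.succ then
    Finsupp.single T' 1 - ((1 - s) / (1 - s ^ m)) • Finsupp.single T 1
  else
    ((s - 1) / (1 - s ^ m)) • Finsupp.single T 1
      + (s * (1 - s ^ (m + 1)) * (1 - s ^ (m - 1)) / (1 - s ^ m) ^ 2) • Finsupp.single T' 1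

/-- The action of `T_i` on the span of the tableaux. -/
def tableauHecke (s : K) (i : Fin n) : (RST n μ →₀ K) →ₗ[K] (RST n μ →₀ K) :=
  Finsupp.linearCombination K (tableauImage s i)

/-! ### Operators on polynomials -/

/-- `s_i^x`: exchange of the variables `x_i` and `x_{i+1}`. -/
def swapX (K : Type*) [Field K] (i : Fin n) :
    MvPolynomial (Fin (n + 1)) K →ₐ[K] MvPolynomial (Fin (n + 1)) K :=
  MvPolynomial.rename (Equiv.swap i.castSucc i.succ)

theorem sub_dvd_sub_swapX (i : Fin n) (f : MvPolynomial (Fin (n + 1)) K) :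
    (MvPolynomial.X i.castSucc - MvPolynomial.X i.succ) ∣ (f - swapX K i f) := by
  induction f using MvPolynomial.induction_on with
  | C a => simp [swapX]
  | add f g hf hg =>
    have : f + g - swapX K i (f + g) = (f - swapX K i f) + (g - swapX K i g) := by
      rw [map_add]; ring
    rw [this]; exact dvd_add hf hg
  | mul_X f k hf =>
    have : f * MvPolynomial.X k - swapX K i (f * MvPolynomial.X k)
        = (f - swapX K i f) * MvPolynomial.X k
          + swapX K i f * (MvPolynomial.X k - swapX K i (MvPolynomial.X k)) := by
      rw [map_mul]; ring
    rw [this]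
    refine dvd_add (Dvd.dvd.mul_right hf _) (Dvd.dvd.mul_left ?_ _)
    simp only [swapX, MvPolynomial.rename_X]
    rcases eq_or_ne k i.castSucc with rfl | h1
    · simp
    rcases eq_or_ne k i.succ with rfl | h2
    · rw [Equiv.swap_apply_right]
      exact ⟨-1, by ring⟩
    · rw [Equiv.swap_apply_of_ne_of_ne h1 h2]; simp

theorem X_sub_X_ne_zero (i : Fin n) :
    (MvPolynomial.X i.castSucc - MvPolynomial.X i.succ : MvPolynomial (Fin (n + 1)) K) ≠ 0 := by
  intro h
  exact (Fin.castSucc_lt_succ (i := i)).ne (MvPolynomial.X_injective (sub_eq_zero.1 h))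

/-- The divided difference `f ↦ (f - f s_i) / (x_i - x_{i+1})`. -/
def dividedDiff (K : Type*) [Field K] (i : Fin n) :
    MvPolynomial (Fin (n + 1)) K →ₗ[K] MvPolynomial (Fin (n + 1)) K where
  toFun f := (sub_dvd_sub_swapX i f).choose
  map_add' f g := by
    apply mul_left_cancel₀ (X_sub_X_ne_zero (K := K) i)
    rw [mul_add, ← (sub_dvd_sub_swapX i f).choose_spec, ← (sub_dvd_sub_swapX i g).choose_spec,
      ← (sub_dvd_sub_swapX i (f + g)).choose_spec, map_add]
    ring
  map_smul' c f := by
    apply mul_left_cancel₀ (X_sub_X_ne_zero (K := K) i)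
    rw [RingHom.id_apply, mul_smul_comm, ← (sub_dvd_sub_swapX i f).choose_spec,
      ← (sub_dvd_sub_swapX i (c • f)).choose_spec, map_smul, smul_sub]

theorem dividedDiff_spec (i : Fin n) (f : MvPolynomial (Fin (n + 1)) K) :
    (MvPolynomial.X i.castSucc - MvPolynomial.X i.succ) * dividedDiff K i f = f - swapX K i f :=
  ((sub_dvd_sub_swapX i f).choose_spec).symm

/-- Multiplication by the variable `x_k`. -/
def mulX (K : Type*) [Field K] (k : Fin (n + 1)) :
    MvPolynomial (Fin (n + 1)) K →ₗ[K] MvPolynomial (Fin (n + 1)) K :=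
  LinearMap.mulLeft K (MvPolynomial.X k)

/-- `δ_i^x`: divided difference, followed by multiplication by `(1 - s) x_{i+1}`. -/
def deltaX (s : K) (i : Fin n) :
    MvPolynomial (Fin (n + 1)) K →ₗ[K] MvPolynomial (Fin (n + 1)) K :=
  (1 - s) • (mulX K i.succ ∘ₗ dividedDiff K i)

/-! ### Vector valued polynomials -/

/-- Polynomials in `x_1, …, x_N` tensored with the span of the tableaux of shape `μ`. -/
abbrev VecPoly (K : Type*) [Field K] (n : ℕ) (μ : YoungDiagram) : Type _ :=
  MvPolynomial (Fin (n + 1)) K ⊗[K] (RST n μ →₀ K)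

/-- The bold operator `T_i = δ_i^x + s_i^x T_i`. -/
def heckeT (s : K) (i : Fin n) : VecPoly K n μ →ₗ[K] VecPoly K n μ :=
  TensorProduct.map (deltaX s i) LinearMap.id
    + TensorProduct.map (swapX K i).toLinearMap (tableauHecke s i)

/-- The inverse `T_i⁻¹ = (T_i + (1 - s)) / s` of the bold operator. -/
def heckeTInv (s : K) (i : Fin n) : VecPoly K n μ →ₗ[K] VecPoly K n μ :=
  s⁻¹ • (heckeT s i + (1 - s) • LinearMap.id)

/-- The raising operator `Φ = T_1⁻¹ T_2⁻¹ ⋯ T_{N-1}⁻¹ x_N`: first `T_1⁻¹` is applied, then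
`T_2⁻¹`, and so on; multiplication by `x_N` comes last. -/
def raising (s : K) (P : VecPoly K n μ) : VecPoly K n μ :=
  TensorProduct.map (mulX K (Fin.last n)) LinearMap.id
    ((List.finRange n).foldl (fun R i => heckeTInv s i R) P)

/-- `ζ s_i`: exchange of two neighbouring entries of a vector. -/
def vecSwap {α : Type*} (i : Fin n) (ζ : Fin (n + 1) → α) : Fin (n + 1) → α :=
  ζ ∘ Equiv.swap i.castSucc i.succ

/-- `[u_1, …, u_N] ↦ [u_2, …, u_N, g(u_1)]`. -/
def vecRotate {α : Type*} (g : α → α) (u : Fin (n + 1) → α) : Fin (n + 1) → α :=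
  Fin.snoc (α := fun _ => α) (fun j : Fin n => u j.succ) (g (u 0))

/-! ### The Yang-Baxter graph -/

/-- The labels `(T, ζ, v, σ)` of the vertices. -/
structure Vertex (K : Type*) (n : ℕ) (μ : YoungDiagram) where
  tab : RST n μ
  spec : Fin (n + 1) → K
  expo : Fin (n + 1) → ℕ
  perm : Fin (n + 1) → Fin (n + 1)

namespace Vertex

open Classical in
/-- The action of the elementary transposition `s_i` on 4-tuples. -/
def swap (x : Vertex K n μ) (i : Fin n) : Vertex K n μ :=
  if x.expo i.succ ≠ x.expo i.castSucc then
    ⟨x.tab, vecSwap i x.spec, vecSwap i x.expo, vecSwap i x.perm⟩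
  else if (x.tab.1.exchange (x.perm i.castSucc) (x.perm i.succ)).IsRST then
    ⟨x.tab.exchange (x.perm i.castSucc) (x.perm i.succ), vecSwap i x.spec, x.expo, x.perm⟩
  else x

/-- The affine action on 4-tuples. -/
def affine (q : K) (x : Vertex K n μ) : Vertex K n μ :=
  ⟨x.tab, vecRotate (fun z => q * z) x.spec, vecRotate (fun k => k + 1) x.expo,
    vecRotate id x.perm⟩

/-- There is an arrow (which is not a fall) labelled `s_i` from `x` to `x.swap i`. -/
def HasArrow (x : Vertex K n μ) (i : Fin n) : Prop :=
  x.expo i.castSucc < x.expo i.succ ∨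
  (x.expo i.castSucc = x.expo i.succ ∧ x.perm i.castSucc < x.perm i.succ ∧
    (x.tab.1.exchange (x.perm i.castSucc) (x.perm i.succ)).IsRST ∧
    x.tab.1.content (x.perm i.succ) + 2 ≤ x.tab.1.content (x.perm i.castSucc))

/-- The root of the graph. -/
def root (s : K) (h : μ.card = n + 1) : Vertex K n μ :=
  ⟨rootRST h, fun j => s ^ (rootRST h).1.content j, fun _ => 0, id⟩

end Vertex

/-- `PathPolynomial q s h x P`: some path without fall leads from the root to the vertex `x`, and
`P` is the polynomial attached to that path. -/
inductive PathPolynomial (q s : K) (h : μ.card = n + 1) :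
    Vertex K n μ → VecPoly K n μ → Prop
  | root : PathPolynomial q s h (Vertex.root s h) (1 ⊗ₜ[K] Finsupp.single (rootRST h) 1)
  | swap (x : Vertex K n μ) (P : VecPoly K n μ) (i : Fin n) (hx : PathPolynomial q s h x P)
      (hi : x.HasArrow i) :
      PathPolynomial q s h (x.swap i)
        (heckeT s i P + ((1 - s) / (1 - x.spec i.succ / x.spec i.castSucc)) • P)
  | affine (x : Vertex K n μ) (P : VecPoly K n μ) (hx : PathPolynomial q s h x P) :
      PathPolynomial q s h (x.affine q) (raising s P)

/-- `P` is the polynomial of a path without fall to a vertex with spectral vector `ζ`. -/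
def IsPolynomialOf (q s : K) (h : μ.card = n + 1) (ζ : Fin (n + 1) → K)
    (P : VecPoly K n μ) : Prop :=
  ∃ x : Vertex K n μ, x.spec = ζ ∧ PathPolynomial q s h x P

/-- All paths without fall to spectral vector `ζ` give the same polynomial, and there is one. -/
def WellDefinedAt (q s : K) (h : μ.card = n + 1) (ζ : Fin (n + 1) → K) : Prop :=
  ∃! P : VecPoly K n μ, IsPolynomialOf q s h ζ P

open Classical in
/-- The Macdonald polynomial `P_ζ`: the polynomial of any path leading to `ζ` (with the value `0`
if there is no such path). -/
def macdonald (q s : K) (h : μ.card = n + 1) (ζ : Fin (n + 1) → K) : VecPoly K n μ :=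
  if hP : ∃ P, IsPolynomialOf q s h ζ P then hP.choose else 0

/-! ### Spectral vectors -/

/-- The rank function `r_v` (as a letter in `Fin (n + 1)`, hence with the term `j = i` of the
count removed). -/
def rankFun (v : Fin (n + 1) → ℕ) (i : Fin (n + 1)) : Fin (n + 1) :=
  ⟨(Finset.univ.filter fun j => (j < i ∧ v i ≤ v j) ∨ (i < j ∧ v i < v j)).card, by
    have hs : (Finset.univ.filter fun j => (j < i ∧ v i ≤ v j) ∨ (i < j ∧ v i < v j))
        ⊂ (Finset.univ : Finset (Fin (n + 1))) := by
      refine (Finset.ssubset_univ_iff).2 fun he => ?_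
      have := he ▸ Finset.mem_univ i
      simp at this
    simpa using Finset.card_lt_card hs⟩

/-- The spectral vector `ζ_{v,T}[i] = q^{v[i]} s^{CT_T[r_v[i]]}`. -/
def spectralVector (q s : K) (v : Fin (n + 1) → ℕ) (T : RST n μ) (i : Fin (n + 1)) : K :=
  q ^ v i * s ^ T.1.content (rankFun v i)

/-- `z ≻ z'`: `z = q^{a} s^{b}`, `z' = q^{c} s^{d}` with `a > c`, or `a = c` and `b ≤ d - 2`. -/
def SpecGT (q s z z' : K) : Prop :=
  ∃ a b c d : ℤ, z = q ^ a * s ^ b ∧ z' = q ^ c * s ^ d ∧ (c < a ∨ (a = c ∧ b ≤ d - 2))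

/-- `z ≁ z'`: `z = q^{a} s^{b}`, `z' = q^{c} s^{d}` with `a = c` and `|b - d| = 1`. -/
def SpecNsim (q s z z' : K) : Prop :=
  ∃ a b c d : ℤ, z = q ^ a * s ^ b ∧ z' = q ^ c * s ^ d ∧ a = c ∧ |b - d| = 1

end

end VVMac

/-!
The proof compares every path of the Yang-Baxter graph with one distinguished path.

Write `b(x, y) = (1 - s) / (1 - y / x)`. Given the quadratic relation, the Yang-Baxter relation for
the operators `T_i + b(x, y)` and the braid relation for the `T_i` imply each other
(`yangBaxter_sub`), even for a single vector and a single choice of parameters. On the basis of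
tableaux, `T_i + b` only exchanges two letters up to a scalar that depends on contents
(`tableauHecke_single`), so the Yang-Baxter relation is evident there, and the braid relation
follows. The relations carry over to vector valued polynomials because the defect of each of them
vanishes on constants and on `x_k P` whenever it vanishes on `P` (`linearMap_eq_zero`). The braid
relations also give the two ways in which the raising operator passes the Hecke operators: `Φ`
turns `T_{i+1}` into `T_i`, and `Φ²` turns `T_1` into `T_{N-1}`
(`raising_heckeT`, `raising_raising_heckeT`).

For an exponent `v` and a tableau `T`, `canonPoly` is the polynomial of a distinguished path to the
vertex `(T, ζ_{v,T}, v, r_v)`: the last arrow is affine if the last entry of `v` is positive, and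
moves the last nonzero entry of `v` to the left otherwise. The core of the proof is `stepsKnown`:
for `v_i < v_{i+1}` the step at `i` maps `canonPoly T v` to `canonPoly T (v s_i)`, and for
`v_i = v_{i+1}` it exchanges two neighbouring letters of `T`, up to a scalar that vanishes exactly
when the exchange is not a tableau. It is proved by induction on `v`: the step at `i` is moved
across the last arrow of the distinguished path by commutation with `Φ` or `Φ²`, by commutation of
distant generators, or by the Yang-Baxter relation.

Consequently each path to the vertex of `(T, v)` has the polynomial `canonPoly T v`. Such a path
exists for all `T` and `v`, and a spectral vector determines `v` and `T`, since a tableau is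
determined by the contents of its letters. So `P_ζ` is well defined and equals `canonPoly T v`. The
formulas are then those of `stepsKnown`; the case `ζ_i ≻ ζ_{i+1}` follows from the opposite arrow
and the quadratic relation (`step_step_swap`).
-/

namespace VVMac

noncomputable section

variable {K : Type*} [Field K] {n : ℕ} {μ : YoungDiagram}

/-! ### Hecke operators on vector valued polynomials -/

/-- Multiplication of vector valued polynomials by the variable `x_k`. -/
def xmul (k : Fin (n + 1)) : VecPoly K n μ →ₗ[K] VecPoly K n μ :=
  TensorProduct.map (mulX K k) LinearMap.id

theorem xmul_tmul (k : Fin (n + 1)) (p : MvPolynomial (Fin (n + 1)) K) (u : RST n μ →₀ K) :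
    xmul k (p ⊗ₜ[K] u) = (MvPolynomial.X k * p) ⊗ₜ[K] u := rfl

theorem xmul_comm (k l : Fin (n + 1)) (P : VecPoly K n μ) :
    xmul k (xmul l P) = xmul l (xmul k P) := by
  induction P using TensorProduct.induction_on with
  | zero => simp
  | tmul p u => rw [xmul_tmul, xmul_tmul, xmul_tmul, xmul_tmul, mul_left_comm]
  | add P Q hP hQ => rw [map_add, map_add, hP, hQ, map_add, map_add]

theorem heckeT_tmul (s : K) (i : Fin n) (p : MvPolynomial (Fin (n + 1)) K) (u : RST n μ →₀ K) :
    heckeT s i (p ⊗ₜ[K] u)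
      = ((1 - s) • (MvPolynomial.X i.succ * dividedDiff K i p)) ⊗ₜ[K] u
        + swapX K i p ⊗ₜ[K] tableauHecke s i u := rfl

theorem swapX_X (i : Fin n) (k : Fin (n + 1)) :
    swapX K i (MvPolynomial.X k) = MvPolynomial.X (Equiv.swap i.castSucc i.succ k) :=
  MvPolynomial.rename_X _ _

theorem dividedDiff_one (i : Fin n) : dividedDiff K i 1 = 0 := by
  apply mul_left_cancel₀ (X_sub_X_ne_zero (K := K) i)
  rw [dividedDiff_spec, map_one, sub_self, mul_zero]

theorem dividedDiff_X_mul (i : Fin n) (k : Fin (n + 1)) (p : MvPolynomial (Fin (n + 1)) K) :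
    dividedDiff K i (MvPolynomial.X k * p)
      = MvPolynomial.X (Equiv.swap i.castSucc i.succ k) * dividedDiff K i p
        + dividedDiff K i (MvPolynomial.X k) * p := by
  apply mul_left_cancel₀ (X_sub_X_ne_zero (K := K) i)
  rw [mul_add, mul_left_comm, ← mul_assoc _ (dividedDiff K i (MvPolynomial.X k)),
    dividedDiff_spec, dividedDiff_spec, dividedDiff_spec, map_mul, swapX_X]
  ring

theorem dividedDiff_X_castSucc (i : Fin n) :
    dividedDiff K i (MvPolynomial.X i.castSucc) = 1 := by
  apply mul_left_cancel₀ (X_sub_X_ne_zero (K := K) i)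
  rw [dividedDiff_spec, swapX_X, Equiv.swap_apply_left, mul_one]

theorem dividedDiff_X_succ (i : Fin n) :
    dividedDiff K i (MvPolynomial.X i.succ) = -1 := by
  apply mul_left_cancel₀ (X_sub_X_ne_zero (K := K) i)
  rw [dividedDiff_spec, swapX_X, Equiv.swap_apply_right]
  ring

theorem dividedDiff_X_of_ne (i : Fin n) {k : Fin (n + 1)} (h1 : k ≠ i.castSucc)
    (h2 : k ≠ i.succ) : dividedDiff K i (MvPolynomial.X k) = 0 := by
  apply mul_left_cancel₀ (X_sub_X_ne_zero (K := K) i)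
  rw [dividedDiff_spec, swapX_X, Equiv.swap_apply_of_ne_of_ne h1 h2, sub_self, mul_zero]

theorem heckeT_one_tmul (s : K) (i : Fin n) (u : RST n μ →₀ K) :
    heckeT s i ((1 : MvPolynomial (Fin (n + 1)) K) ⊗ₜ[K] u) = 1 ⊗ₜ[K] tableauHecke s i u := by
  rw [heckeT_tmul, dividedDiff_one, mul_zero, smul_zero, TensorProduct.zero_tmul, zero_add,
    map_one]

theorem heckeT_xmul_castSucc (s : K) (i : Fin n) (P : VecPoly K n μ) :
    heckeT s i (xmul i.castSucc P)
      = xmul i.succ (heckeT s i P) + (1 - s) • xmul i.succ P := by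
  induction P using TensorProduct.induction_on with
  | zero => simp
  | tmul p u =>
    rw [xmul_tmul, heckeT_tmul, heckeT_tmul, map_add, xmul_tmul, xmul_tmul, xmul_tmul,
      dividedDiff_X_mul, dividedDiff_X_castSucc, map_mul, swapX_X, Equiv.swap_apply_left,
      one_mul, mul_add, smul_add, TensorProduct.add_tmul, TensorProduct.smul_tmul',
      mul_smul_comm]
    abel
  | add P Q hP hQ => simp only [map_add, hP, hQ, smul_add]; abel

theorem heckeT_xmul_succ (s : K) (i : Fin n) (P : VecPoly K n μ) :
    heckeT s i (xmul i.succ P)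
      = xmul i.castSucc (heckeT s i P) - (1 - s) • xmul i.succ P := by
  induction P using TensorProduct.induction_on with
  | zero => simp
  | tmul p u =>
    rw [xmul_tmul, heckeT_tmul, heckeT_tmul, map_add, xmul_tmul, xmul_tmul,
      dividedDiff_X_mul, dividedDiff_X_succ, map_mul, swapX_X, Equiv.swap_apply_right,
      neg_one_mul, mul_add, smul_add, TensorProduct.add_tmul, TensorProduct.smul_tmul',
      mul_smul_comm, mul_neg, smul_neg, TensorProduct.neg_tmul, mul_left_comm]
    abel
  | add P Q hP hQ => simp only [map_add, hP, hQ, smul_add]; abel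

theorem heckeT_xmul_of_ne (s : K) (i : Fin n) {k : Fin (n + 1)} (h1 : k ≠ i.castSucc)
    (h2 : k ≠ i.succ) (P : VecPoly K n μ) :
    heckeT s i (xmul k P) = xmul k (heckeT s i P) := by
  induction P using TensorProduct.induction_on with
  | zero => simp
  | tmul p u =>
    rw [xmul_tmul, heckeT_tmul, heckeT_tmul, map_add, xmul_tmul, xmul_tmul,
      dividedDiff_X_mul, dividedDiff_X_of_ne i h1 h2, map_mul, swapX_X,
      Equiv.swap_apply_of_ne_of_ne h1 h2, zero_mul, add_zero, mul_smul_comm, mul_left_comm]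
  | add P Q hP hQ => simp only [map_add, hP, hQ]

/-- Vector valued polynomials are generated from the constants `1 ⊗ u` by the variables, so a linear
map vanishes if it vanishes on constants and its kernel is stable under the variables. -/
theorem linearMap_eq_zero (B : VecPoly K n μ →ₗ[K] VecPoly K n μ)
    (h1 : ∀ u, B (1 ⊗ₜ[K] u) = 0) (hx : ∀ k P, B P = 0 → B (xmul k P) = 0)
    (P : VecPoly K n μ) : B P = 0 := by
  induction P using TensorProduct.induction_on with
  | zero => simp
  | add P Q hP hQ => rw [map_add, hP, hQ, add_zero]
  | tmul p u =>
    induction p using MvPolynomial.induction_on with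
    | C a =>
      rw [← mul_one (MvPolynomial.C a), ← MvPolynomial.smul_eq_C_mul, TensorProduct.smul_tmul,
        h1]
    | add p r hp hr => rw [TensorProduct.add_tmul, map_add, hp, hr, add_zero]
    | mul_X p k hp => rw [mul_comm, ← xmul_tmul, hx k _ hp]

/-- The quadratic relation is inherited from the tableaux. -/
theorem heckeT_quadratic_of (s : K) (i : Fin n)
    (hV : ∀ u : RST n μ →₀ K, tableauHecke s i (tableauHecke s i u)
      = (s - 1) • tableauHecke s i u + s • u) (P : VecPoly K n μ) :
    heckeT s i (heckeT s i P) = (s - 1) • heckeT s i P + s • P := by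
  have := linearMap_eq_zero
    (heckeT s i ∘ₗ heckeT s i - (s - 1) • heckeT s i - s • LinearMap.id) (fun u => ?_)
    (fun k P hP => ?_) P
  · simp only [LinearMap.sub_apply, LinearMap.comp_apply, LinearMap.smul_apply,
      LinearMap.id_apply] at this
    rw [sub_sub, sub_eq_zero] at this
    exact this
  · simp only [LinearMap.sub_apply, LinearMap.comp_apply, LinearMap.smul_apply,
      LinearMap.id_apply, heckeT_one_tmul, hV, TensorProduct.tmul_add, TensorProduct.tmul_smul]
    abel
  · simp only [LinearMap.sub_apply, LinearMap.comp_apply, LinearMap.smul_apply,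
      LinearMap.id_apply] at hP ⊢
    have hP' : heckeT s i (heckeT s i P) = (s - 1) • heckeT s i P + s • P := by
      rw [sub_sub, sub_eq_zero] at hP; exact hP
    rcases eq_or_ne k i.castSucc with rfl | h1
    · simp only [heckeT_xmul_castSucc, heckeT_xmul_succ, map_add, map_smul, hP']
      module
    rcases eq_or_ne k i.succ with rfl | h2
    · simp only [heckeT_xmul_castSucc, heckeT_xmul_succ, map_add, map_sub, map_smul, hP']
      module
    · simp only [heckeT_xmul_of_ne s i h1 h2, hP', map_add, map_smul]
      abel

/-- Commutation of distant generators is inherited from the tableaux. -/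
theorem heckeT_comm_of (s : K) (i j : Fin n) (hij : (i : ℕ) + 1 < j)
    (hV : ∀ u : RST n μ →₀ K, tableauHecke s i (tableauHecke s j u)
      = tableauHecke s j (tableauHecke s i u)) (P : VecPoly K n μ) :
    heckeT s i (heckeT s j P) = heckeT s j (heckeT s i P) := by
  have := linearMap_eq_zero
    (heckeT s i ∘ₗ heckeT s j - heckeT s j ∘ₗ heckeT s i) (fun u => ?_)
    (fun k P hP => ?_) P
  · simpa only [LinearMap.sub_apply, LinearMap.comp_apply, sub_eq_zero] using this
  · simp only [LinearMap.sub_apply, LinearMap.comp_apply, heckeT_one_tmul, hV, sub_self]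
  · simp only [LinearMap.sub_apply, LinearMap.comp_apply, sub_eq_zero] at hP ⊢
    have a1 : i.castSucc ≠ j.castSucc := by simp [Fin.ext_iff]; omega
    have a2 : i.castSucc ≠ j.succ := by simp [Fin.ext_iff]; omega
    have a3 : i.succ ≠ j.castSucc := by simp [Fin.ext_iff]; omega
    have a4 : i.succ ≠ j.succ := by simp [Fin.ext_iff]; omega
    rcases eq_or_ne k i.castSucc with rfl | h1
    · simp only [heckeT_xmul_castSucc, heckeT_xmul_of_ne s j a1 a2, heckeT_xmul_of_ne s j a3 a4,
        map_add, map_smul, hP]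
    rcases eq_or_ne k i.succ with rfl | h2
    · simp only [heckeT_xmul_succ, heckeT_xmul_of_ne s j a1 a2, heckeT_xmul_of_ne s j a3 a4,
        map_sub, map_smul, hP]
    rcases eq_or_ne k j.castSucc with rfl | h3
    · simp only [heckeT_xmul_castSucc, heckeT_xmul_of_ne s i a1.symm a3.symm,
        heckeT_xmul_of_ne s i a2.symm a4.symm, map_add, map_smul, hP]
    rcases eq_or_ne k j.succ with rfl | h4
    · simp only [heckeT_xmul_succ, heckeT_xmul_of_ne s i a1.symm a3.symm,
        heckeT_xmul_of_ne s i a2.symm a4.symm, map_sub, map_smul, hP]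
    · simp only [heckeT_xmul_of_ne s i h1 h2, heckeT_xmul_of_ne s j h3 h4, hP]

/-- The braid relation is inherited from the tableaux. The quadratic relation enters because
`B (x_k P)`, for the defect `B` of the braid relation, contains a multiple of
`(T_i² - T_j²) P + (1 - s) (T_i - T_j) P`. -/
theorem heckeT_braid_of (s : K) (i j : Fin n) (hij : (i : ℕ) + 1 = j)
    (hq : ∀ (k : Fin n) (P : VecPoly K n μ),
      heckeT s k (heckeT s k P) = (s - 1) • heckeT s k P + s • P)
    (hV : ∀ u : RST n μ →₀ K, tableauHecke s i (tableauHecke s j (tableauHecke s i u))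
      = tableauHecke s j (tableauHecke s i (tableauHecke s j u))) (P : VecPoly K n μ) :
    heckeT s i (heckeT s j (heckeT s i P)) = heckeT s j (heckeT s i (heckeT s j P)) := by
  have := linearMap_eq_zero
    (heckeT s i ∘ₗ heckeT s j ∘ₗ heckeT s i - heckeT s j ∘ₗ heckeT s i ∘ₗ heckeT s j)
    (fun u => ?_) (fun k P hP => ?_) P
  · simpa only [LinearMap.sub_apply, LinearMap.comp_apply, sub_eq_zero] using this
  · simp only [LinearMap.sub_apply, LinearMap.comp_apply, heckeT_one_tmul, hV, sub_self]
  · simp only [LinearMap.sub_apply, LinearMap.comp_apply, sub_eq_zero] at hP ⊢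
    have e : i.succ = j.castSucc := by simp [Fin.ext_iff]; omega
    have a1 : i.castSucc ≠ j.castSucc := by simp [Fin.ext_iff]; omega
    have a2 : i.castSucc ≠ j.succ := by simp [Fin.ext_iff]; omega
    have a3 : j.succ ≠ i.castSucc := a2.symm
    have a4 : j.succ ≠ i.succ := by simp [Fin.ext_iff]; omega
    have X1 : ∀ Q : VecPoly K n μ, heckeT s i (xmul i.castSucc Q)
        = xmul j.castSucc (heckeT s i Q) + (1 - s) • xmul j.castSucc Q := fun Q => by
      rw [heckeT_xmul_castSucc, e]
    have X2 : ∀ Q : VecPoly K n μ, heckeT s i (xmul j.castSucc Q)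
        = xmul i.castSucc (heckeT s i Q) - (1 - s) • xmul j.castSucc Q := fun Q => by
      rw [← e, heckeT_xmul_succ]
    have X3 := heckeT_xmul_of_ne (μ := μ) s i a3 a4
    have Y1 := heckeT_xmul_of_ne (μ := μ) s j a1 a2
    have Y2 := heckeT_xmul_castSucc (μ := μ) s j
    have Y3 := heckeT_xmul_succ (μ := μ) s j
    rcases eq_or_ne k i.castSucc with rfl | h1
    · simp only [X1, X3, Y1, Y2, map_add, map_smul, hP, hq]
      module
    rcases eq_or_ne k j.castSucc with rfl | h2
    · simp only [X1, X2, X3, Y1, Y2, Y3, map_add, map_sub, map_smul, hP]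
      module
    rcases eq_or_ne k j.succ with rfl | h3
    · simp only [X2, X3, Y1, Y2, Y3, map_add, map_sub, map_smul, hP, hq]
      module
    · simp only [heckeT_xmul_of_ne s i h1 (e ▸ h2), heckeT_xmul_of_ne s j h2 h3, hP]

/-! ### The Yang-Baxter relation -/

/-- The coefficient `(1 - s) / (1 - y / x)` that is added to `T_i` on a step of the Yang-Baxter
graph, where `x` and `y` are the entries `i` and `i + 1` of the spectral vector. -/
def stepCoeff (s x y : K) : K := (1 - s) / (1 - y / x)

theorem stepCoeff_eq {s x y : K} (hx : x ≠ 0) : stepCoeff s x y = (1 - s) * x / (x - y) := by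
  rw [stepCoeff, one_sub_div hx, div_div_eq_mul_div]

theorem stepCoeff_add_swap {s x y : K} (hx : x ≠ 0) (hy : y ≠ 0) (hxy : x ≠ y) :
    stepCoeff s x y + stepCoeff s y x = 1 - s := by
  rw [stepCoeff_eq hx, stepCoeff_eq hy]
  have h1 := sub_ne_zero.2 hxy
  have h2 := sub_ne_zero.2 hxy.symm
  field_simp
  ring

theorem stepCoeff_mul_swap {s x y : K} (hx : x ≠ 0) (hy : y ≠ 0) (hxy : x ≠ y) :
    s + stepCoeff s x y * stepCoeff s y x = (x - s * y) * (s * x - y) / (x - y) ^ 2 := by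
  rw [stepCoeff_eq hx, stepCoeff_eq hy]
  have h1 := sub_ne_zero.2 hxy
  have h2 := sub_ne_zero.2 hxy.symm
  have h3 : y - x = -(x - y) := by ring
  rw [h3]
  field_simp
  ring

/-- The condition on the three parameters of the Yang-Baxter relation. -/
theorem stepCoeff_triple {s x y z : K} (hx : x ≠ 0) (hy : y ≠ 0) (hxy : x ≠ y)
    (hxz : x ≠ z) (hyz : y ≠ z) :
    stepCoeff s x z * (stepCoeff s x y + stepCoeff s y z - (1 - s))
      = stepCoeff s x y * stepCoeff s y z := by
  rw [stepCoeff_eq hx, stepCoeff_eq hy, stepCoeff_eq hx]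
  have h1 := sub_ne_zero.2 hxy
  have h2 := sub_ne_zero.2 hxz
  have h3 := sub_ne_zero.2 hyz
  field_simp
  ring

section Algebra

variable {V : Type*} [AddCommGroup V] [Module K V]

/-- For operators satisfying the quadratic relation, the defect of the Yang-Baxter relation is the
defect of the braid relation. Hence either relation follows from the other one, even when it
is known for a single vector and a single choice of parameters. -/
theorem yangBaxter_sub (s : K) (A B : V →ₗ[K] V)
    (hA : ∀ u, A (A u) = (s - 1) • A u + s • u) (hB : ∀ u, B (B u) = (s - 1) • B u + s • u)
    {α β γ : K} (h : β * (α + γ - (1 - s)) = α * γ) (u : V) :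
    (A (B (A u + α • u) + β • (A u + α • u)) + γ • (B (A u + α • u) + β • (A u + α • u)))
      - (B (A (B u + γ • u) + β • (B u + γ • u)) + α • (A (B u + γ • u) + β • (B u + γ • u)))
      = A (B (A u)) - B (A (B u)) := by
  simp only [map_add, map_smul, hA, hB]
  linear_combination (norm := module) h • (A u) - h • (B u)

/-- Two steps with opposite parameters multiply by a scalar. -/
theorem step_step_swap (s : K) (A : V →ₗ[K] V)
    (hA : ∀ u, A (A u) = (s - 1) • A u + s • u) {α β : K} (h : α + β = 1 - s) (u : V) :
    A (A u + α • u) + β • (A u + α • u) = (s + α * β) • u := by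
  simp only [map_add, map_smul, hA]
  linear_combination (norm := module) h • (A u)

end Algebra

/-! ### Geometry of reverse standard tableaux -/

namespace Filling

theorem eq_of_row_col {f : Filling n μ} {a b : Fin (n + 1)} (hr : f.row a = f.row b)
    (hc : f.col a = f.col b) : a = b :=
  f.injective (Subtype.ext (Prod.ext hr hc))

theorem exists_letter {f : Filling n μ} {a : Fin (n + 1)} {r c : ℕ} (hr : r ≤ f.row a)
    (hc : c ≤ f.col a) : ∃ d, f.row d = r ∧ f.col d = c := by
  have hm : (r, c) ∈ μ.cells :=
    (YoungDiagram.mem_cells _).2 (μ.up_left_mem hr hc ((YoungDiagram.mem_cells _).1 (f a).2))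
  refine ⟨f.symm ⟨(r, c), hm⟩, ?_, ?_⟩ <;> simp [row, col]

/-- In a reverse standard tableau the letters decrease towards the south-east. -/
theorem IsRST.lt_of_le {f : Filling n μ} (hf : f.IsRST) {a b : Fin (n + 1)}
    (hr : f.row a ≤ f.row b) (hc : f.col a ≤ f.col b) (hab : a ≠ b) : b < a := by
  obtain ⟨d, hdr, hdc⟩ := exists_letter (f := f) (a := b) hr le_rfl
  have h1 : d ≤ a := by
    rcases hc.lt_or_eq with h | h
    · exact (hf.1 a d hdr.symm (by rw [hdc]; exact h)).le
    · exact (eq_of_row_col hdr (hdc.trans h.symm)).le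
  have h2 : b ≤ d := by
    rcases hr.lt_or_eq with h | h
    · exact (hf.2 d b hdc (by rw [hdr]; exact h)).le
    · exact (eq_of_row_col (h.symm.trans hdr.symm) hdc.symm).le
  exact lt_of_le_of_ne (h2.trans h1) hab.symm

/-- The letters `i` and `i + 1` occupy adjacent cells of a row or of a column, or one of them lies
strictly to the north-east of the other. -/
theorem IsRST.adjacent_cases {f : Filling n μ} (hf : f.IsRST) (i : Fin n) :
    (f.row i.castSucc = f.row i.succ ∧ f.col i.castSucc = f.col i.succ + 1) ∨
    (f.col i.castSucc = f.col i.succ ∧ f.row i.castSucc = f.row i.succ + 1) ∨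
    (f.row i.castSucc < f.row i.succ ∧ f.col i.succ < f.col i.castSucc) ∨
    (f.row i.succ < f.row i.castSucc ∧ f.col i.castSucc < f.col i.succ) := by
  have hne : i.castSucc ≠ i.succ := (Fin.castSucc_lt_succ (i := i)).ne
  have hse : ¬ (f.row i.castSucc ≤ f.row i.succ ∧ f.col i.castSucc ≤ f.col i.succ) := fun h =>
    absurd (hf.lt_of_le h.1 h.2 hne) (Fin.castSucc_lt_succ (i := i)).not_gt
  -- no letter lies strictly between two neighbouring letters
  have hbetween : ∀ d, ¬ (i.castSucc < d ∧ d < i.succ) := fun d hd => by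
    have h1 := Fin.lt_def.1 hd.1
    have h2 := Fin.lt_def.1 hd.2
    simp at h1 h2
    omega
  rcases lt_trichotomy (f.row i.castSucc) (f.row i.succ) with hr | hr | hr
  · exact Or.inr (Or.inr (Or.inl ⟨hr, by omega⟩))
  · refine Or.inl ⟨hr, ?_⟩
    by_contra hc
    obtain ⟨d, hdr, hdc⟩ := exists_letter (f := f) (a := i.castSucc) (r := f.row i.castSucc)
      (c := f.col i.succ + 1) le_rfl (by omega)
    exact hbetween d ⟨hf.1 d _ hdr (by omega), hf.1 _ d (by omega) (by omega)⟩
  · rcases lt_trichotomy (f.col i.castSucc) (f.col i.succ) with hc | hc | hc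
    · exact Or.inr (Or.inr (Or.inr ⟨hr, hc⟩))
    · refine Or.inr (Or.inl ⟨hc, ?_⟩)
      by_contra hc'
      obtain ⟨d, hdr, hdc⟩ := exists_letter (f := f) (a := i.castSucc)
        (r := f.row i.succ + 1) (c := f.col i.castSucc) (by omega) le_rfl
      exact hbetween d ⟨hf.2 d _ hdc (by omega), hf.2 _ d (by omega) (by omega)⟩
    · obtain ⟨d, hdr, hdc⟩ := exists_letter (f := f) (a := i.castSucc)
        (r := f.row i.succ) (c := f.col i.castSucc) (by omega) le_rfl
      exact absurd ⟨hf.2 d _ hdc (by omega), hf.1 _ d (by omega) (by omega)⟩ (hbetween d)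

theorem IsRST.content_sub_ne_zero {f : Filling n μ} (hf : f.IsRST) (i : Fin n) :
    f.content i.succ - f.content i.castSucc ≠ 0 := by
  have := hf.adjacent_cases i
  unfold content
  omega

/-- Two letters of equal content are separated by at least two other letters. -/
theorem IsRST.add_three_le_of_content_eq {f : Filling n μ} (hf : f.IsRST) {a b : Fin (n + 1)}
    (hab : a < b) (hc : f.content a = f.content b) : (a : ℕ) + 3 ≤ b := by
  have hrc : f.row b < f.row a ∧ f.col b < f.col a := by
    have : ¬ (f.row a ≤ f.row b ∧ f.col a ≤ f.col b) := fun h =>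
      absurd (hf.lt_of_le h.1 h.2 hab.ne) hab.not_gt
    unfold content at hc
    omega
  obtain ⟨d, hdr, hdc⟩ := exists_letter (f := f) (a := a) (r := f.row b) (c := f.col a)
    hrc.1.le le_rfl
  obtain ⟨e, her, hec⟩ := exists_letter (f := f) (a := a) (r := f.row a) (c := f.col b)
    le_rfl hrc.2.le
  have h1 := Fin.lt_def.1 (hf.2 d a hdc (by omega))
  have h2 := Fin.lt_def.1 (hf.1 b d hdr.symm (by omega))
  have h3 := Fin.lt_def.1 (hf.1 e a her (by omega))
  have h4 := Fin.lt_def.1 (hf.2 b e hec.symm (by omega))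
  have h5 : (d : ℕ) ≠ e := fun h => by
    have := Fin.ext h
    subst this
    omega
  omega

/-- A reverse standard tableau is determined by the contents of its letters. -/
theorem IsRST.eq_of_content_eq {f g : Filling n μ} (hf : f.IsRST) (hg : g.IsRST)
    (hfg : ∀ a, f.content a = g.content a) : f = g := by
  suffices h : ∀ k : ℕ, ∀ a : Fin (n + 1), (a : ℕ) + k = n → f.row a = g.row a by
    refine Equiv.ext fun a => Subtype.ext ?_
    have hr := h (n - a) a (by omega)
    refine Prod.ext hr ?_
    have := hfg a
    unfold content at this
    change f.col a = g.col a
    omega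
  intro k
  induction k using Nat.strong_induction_on with
  | _ k ih =>
    intro a hak
    -- if the cells of `a` differ, the north-western one of the two is occupied, in the other
    -- tableau, by a larger letter, whose position is already known to agree
    have key : ∀ f g : Filling n μ, f.IsRST → g.IsRST → (∀ a, f.content a = g.content a) →
        (∀ m < k, ∀ a : Fin (n + 1), (a : ℕ) + m = n → f.row a = g.row a) →
        ¬ f.row a < g.row a := by
      intro f g _ hg hfg ih hlt
      have hca := hfg a
      unfold content at hca
      obtain ⟨b, hbr, hbc⟩ := exists_letter (f := g) (a := a) (r := f.row a) (c := f.col a)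
        hlt.le (by omega)
      have hba : a < b := hg.lt_of_le (by omega) (by omega) (by rintro rfl; omega)
      have hrb := ih (n - b) (by have := Fin.lt_def.1 hba; omega) b (by omega)
      have hcb := hfg b
      unfold content at hcb
      exact hba.ne' (eq_of_row_col (f := f) (by omega) (by omega))
    have h1 := key f g hf hg hfg ih
    have h2 := key g f hg hf (fun a => (hfg a).symm) (fun m hm b hb => (ih m hm b hb).symm)
    omega

theorem row_exchange (f : Filling n μ) (a b c : Fin (n + 1)) :
    (f.exchange a b).row c = f.row (Equiv.swap a b c) := rfl

theorem col_exchange (f : Filling n μ) (a b c : Fin (n + 1)) :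
    (f.exchange a b).col c = f.col (Equiv.swap a b c) := rfl

/-- The transposition of two neighbours reverses the order of this pair only. -/
theorem lt_of_swap_lt {i : Fin n} {x y : Fin (n + 1)}
    (h : Equiv.swap i.castSucc i.succ y < Equiv.swap i.castSucc i.succ x)
    (hxy : ¬ (x = i.castSucc ∧ y = i.succ)) : y < x := by
  rw [Fin.lt_def] at h ⊢
  simp only [Equiv.swap_apply_def, Fin.ext_iff] at h hxy
  split_ifs at h <;> simp_all <;> omega

theorem IsRST.exchange_iff {f : Filling n μ} (hf : f.IsRST) (i : Fin n) :
    (f.exchange i.castSucc i.succ).IsRST ↔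
      f.row i.castSucc ≠ f.row i.succ ∧ f.col i.castSucc ≠ f.col i.succ := by
  constructor
  · intro h
    rcases hf.adjacent_cases i with h' | h' | h' | h'
    · refine absurd (h.1 i.castSucc i.succ ?_ ?_) (Fin.castSucc_lt_succ (i := i)).not_gt <;>
        simp only [row_exchange, col_exchange, Equiv.swap_apply_left,
          Equiv.swap_apply_right] <;> omega
    · refine absurd (h.2 i.castSucc i.succ ?_ ?_) (Fin.castSucc_lt_succ (i := i)).not_gt <;>
        simp only [row_exchange, col_exchange, Equiv.swap_apply_left,
          Equiv.swap_apply_right] <;> omega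
    · omega
    · omega
  · rintro ⟨hr, hc⟩
    refine ⟨fun a b h1 h2 => lt_of_swap_lt (hf.1 _ _ h1 h2) ?_,
      fun a b h1 h2 => lt_of_swap_lt (hf.2 _ _ h1 h2) ?_⟩
    · rintro ⟨rfl, rfl⟩
      simp only [row_exchange, Equiv.swap_apply_left, Equiv.swap_apply_right] at h1
      exact hr h1.symm
    · rintro ⟨rfl, rfl⟩
      simp only [col_exchange, Equiv.swap_apply_left, Equiv.swap_apply_right] at h1
      exact hc h1.symm

end Filling

/-! ### The Hecke relations on tableaux -/

/-- Content of the letter `a`. -/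
def RST.content (T : RST n μ) (a : Fin (n + 1)) : ℤ := T.1.content a

theorem RST.content_sub_ne_zero (T : RST n μ) (i : Fin n) :
    T.content i.succ - T.content i.castSucc ≠ 0 :=
  T.2.content_sub_ne_zero i

/-- The coefficient of the exchanged tableau in the image of a tableau under `T_i`, where `m` is
the content of `i + 1` minus the content of `i`. It vanishes for `m = ±1`, which is the case of
neighbouring cells, where the exchange is not a reverse standard tableau. -/
def exchangeCoeff (s : K) (m : ℤ) : K :=
  if m = 1 ∨ m = -1 then 0
  else if m < 0 then 1
  else s * (1 - s ^ (m + 1)) * (1 - s ^ (m - 1)) / (1 - s ^ m) ^ 2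

theorem stepCoeff_zpow {s : K} (hs : s ≠ 0) (a b : ℤ) :
    stepCoeff s (s ^ a) (s ^ b) = (1 - s) / (1 - s ^ (b - a)) := by
  rw [stepCoeff, zpow_sub₀ hs]

theorem zpow_ne_zpow {s : K} (hs : s ≠ 0) (hs1 : ∀ b : ℤ, s ^ b = 1 → b = 0) {a b : ℤ}
    (hab : a ≠ b) : s ^ a ≠ s ^ b := fun h => by
  refine hab (sub_eq_zero.1 (hs1 (a - b) ?_))
  rw [zpow_sub₀ hs, h, div_self (zpow_ne_zero _ hs)]

theorem exchangeCoeff_mul_neg {s : K} (hs : s ≠ 0) (hs1 : ∀ b : ℤ, s ^ b = 1 → b = 0)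
    {a b : ℤ} (hab : a ≠ b) :
    exchangeCoeff s (b - a) * exchangeCoeff s (a - b)
      = s + stepCoeff s (s ^ a) (s ^ b) * stepCoeff s (s ^ b) (s ^ a) := by
  have key : ∀ a b : ℤ, a < b →
      exchangeCoeff s (b - a) * exchangeCoeff s (a - b)
      = s + stepCoeff s (s ^ a) (s ^ b) * stepCoeff s (s ^ b) (s ^ a) := by
    intro a b hab
    have hne := zpow_ne_zpow hs hs1 hab.ne
    rw [stepCoeff_mul_swap (zpow_ne_zero _ hs) (zpow_ne_zero _ hs) hne]
    have e1 : s ^ b = s ^ a * s ^ (b - a) := by rw [← zpow_add₀ hs]; congr 1; omega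
    have ha : s ^ a ≠ 0 := zpow_ne_zero _ hs
    have hm : (1 : K) - s ^ (b - a) ≠ 0 := by
      intro h
      have := hs1 _ (sub_eq_zero.1 h).symm
      omega
    have e2 : (s ^ a - s * s ^ b) * (s * s ^ a - s ^ b) / (s ^ a - s ^ b) ^ 2
        = s * (1 - s ^ (b - a + 1)) * (1 - s ^ (b - a - 1)) / (1 - s ^ (b - a)) ^ 2 := by
      have : s ^ a - s ^ a * s ^ (b - a) = s ^ a * (1 - s ^ (b - a)) := by ring
      rw [e1, zpow_add_one₀ hs, zpow_sub_one₀ hs, this]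
      field_simp
    rw [e2]
    unfold exchangeCoeff
    by_cases h1 : b - a = 1
    · rw [if_pos (Or.inl h1), h1]
      simp
    · rw [if_neg (by omega), if_neg (by omega), if_neg (by omega), if_pos (by omega), mul_one]
  rcases lt_or_gt_of_ne hab with h | h
  · exact key a b h
  · rw [mul_comm, key b a h, mul_comm (stepCoeff _ _ _)]

/-- Exchange of the neighbouring letters `i` and `i + 1`. -/
def RST.adjSwap (T : RST n μ) (i : Fin n) : RST n μ := T.exchange i.castSucc i.succ

theorem RST.exchange_isRST_iff (T : RST n μ) (i : Fin n) :
    (T.1.exchange i.castSucc i.succ).IsRST ↔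
      ¬ (T.content i.succ - T.content i.castSucc = 1 ∨
        T.content i.succ - T.content i.castSucc = -1) := by
  rw [T.2.exchange_iff i]
  have := T.2.adjacent_cases i
  unfold RST.content Filling.content
  omega

theorem exchangeCoeff_eq_zero_or (s : K) (T : RST n μ) (i : Fin n) :
    exchangeCoeff s (T.content i.succ - T.content i.castSucc) = 0 ∨
      (T.1.exchange i.castSucc i.succ).IsRST := by
  rw [T.exchange_isRST_iff i]
  unfold exchangeCoeff
  split_ifs with h
  · exact Or.inl rfl
  · exact Or.inr h
  · exact Or.inr h

theorem RST.adjSwap_eq {T : RST n μ} {i : Fin n}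
    (h : (T.1.exchange i.castSucc i.succ).IsRST) : T.adjSwap i = ⟨_, h⟩ := dif_pos h

theorem RST.content_adjSwap {T : RST n μ} {i : Fin n}
    (h : (T.1.exchange i.castSucc i.succ).IsRST) (a : Fin (n + 1)) :
    (T.adjSwap i).content a = T.content (Equiv.swap i.castSucc i.succ a) := by
  rw [adjSwap_eq h]
  rfl

theorem RST.content_adjSwap_of_ne (T : RST n μ) (i : Fin n) {a : Fin (n + 1)}
    (h1 : a ≠ i.castSucc) (h2 : a ≠ i.succ) : (T.adjSwap i).content a = T.content a := by
  by_cases h : (T.1.exchange i.castSucc i.succ).IsRST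
  · rw [content_adjSwap h, Equiv.swap_apply_of_ne_of_ne h1 h2]
  · have : T.adjSwap i = T := dif_neg h
    rw [this]

theorem RST.ext_content {T U : RST n μ} (h : ∀ a, T.content a = U.content a) : T = U :=
  Subtype.ext (T.2.eq_of_content_eq U.2 h)

theorem RST.adjSwap_adjSwap {T : RST n μ} {i : Fin n}
    (h : (T.1.exchange i.castSucc i.succ).IsRST) : (T.adjSwap i).adjSwap i = T := by
  have h' : ((T.adjSwap i).1.exchange i.castSucc i.succ).IsRST := by
    rw [RST.exchange_isRST_iff] at h ⊢
    rw [content_adjSwap ((RST.exchange_isRST_iff T i).2 h),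
      content_adjSwap ((RST.exchange_isRST_iff T i).2 h), Equiv.swap_apply_left,
      Equiv.swap_apply_right]
    omega
  refine RST.ext_content fun a => ?_
  rw [content_adjSwap h', content_adjSwap h, Equiv.swap_apply_self]

/-- On the tableau basis, the Yang-Baxter step exchanges letters up to a scalar. -/
theorem tableauHecke_single {s : K} (hs : s ≠ 0) (hs1 : ∀ b : ℤ, s ^ b = 1 → b = 0)
    (i : Fin n) (T : RST n μ) :
    tableauHecke s i (Finsupp.single T 1)
      + stepCoeff s (s ^ T.content i.castSucc) (s ^ T.content i.succ) • Finsupp.single T 1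
      = exchangeCoeff s (T.content i.succ - T.content i.castSucc)
        • Finsupp.single (T.adjSwap i) 1 := by
  have h1s : (1 : K) - s ≠ 0 := by
    intro h
    have := hs1 1 (by rw [zpow_one]; exact (sub_eq_zero.1 h).symm)
    omega
  rw [stepCoeff_zpow hs, tableauHecke, Finsupp.linearCombination_single, one_smul, tableauImage]
  have hm : T.content i.succ - T.content i.castSucc
      = T.1.content i.succ - T.1.content i.castSucc := rfl
  have hcase := T.2.adjacent_cases i
  rw [← hm]
  rcases hcase with ⟨hr, hc⟩ | ⟨hc, hr⟩ | ⟨hr, hc⟩ | ⟨hr, hc⟩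
  · have hm1 : T.content i.succ - T.content i.castSucc = -1 := by
      unfold RST.content Filling.content; omega
    rw [if_pos hr, hm1, exchangeCoeff, if_pos (Or.inr rfl), zero_smul, ← add_smul,
      zpow_neg_one]
    have : s + (1 - s) / (1 - s⁻¹) = 0 := by
      have : s - 1 ≠ 0 := fun h => h1s (by rw [← neg_sub, h, neg_zero])
      field_simp
      ring
    rw [this, zero_smul]
  · have hm1 : T.content i.succ - T.content i.castSucc = 1 := by
      unfold RST.content Filling.content; omega
    rw [if_neg (by omega), if_pos hc, hm1, exchangeCoeff, if_pos (Or.inl rfl), zero_smul,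
      zpow_one, div_self h1s, one_smul, neg_add_cancel]
  · have hm1 : T.content i.succ - T.content i.castSucc < -1 := by
      unfold RST.content Filling.content; omega
    rw [if_neg (by omega), if_neg (by omega), if_pos hr, exchangeCoeff, if_neg (by omega),
      if_pos (by omega), one_smul, sub_add_cancel]
    rfl
  · have hm1 : 1 < T.content i.succ - T.content i.castSucc := by
      unfold RST.content Filling.content; omega
    rw [if_neg (by omega), if_neg (by omega), if_neg (by omega), exchangeCoeff,
      if_neg (by omega), if_neg (by omega), add_right_comm, ← add_smul, ← add_div,
      sub_add_sub_cancel, sub_self, zero_div, zero_smul, zero_add]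
    rfl

theorem tableauHecke_quadratic {s : K} (hs : s ≠ 0) (hs1 : ∀ b : ℤ, s ^ b = 1 → b = 0)
    (i : Fin n) (u : RST n μ →₀ K) :
    tableauHecke s i (tableauHecke s i u) = (s - 1) • tableauHecke s i u + s • u := by
  suffices h : tableauHecke s i ∘ₗ tableauHecke s i
      = (s - 1) • tableauHecke s i + s • (LinearMap.id : (RST n μ →₀ K) →ₗ[K] _) from
    LinearMap.congr_fun h u
  refine Finsupp.lhom_ext' fun T => LinearMap.ext_ring ?_
  simp only [LinearMap.comp_apply, LinearMap.add_apply, LinearMap.smul_apply, LinearMap.id_apply,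
    Finsupp.lsingle_apply]
  have hne : T.content i.castSucc ≠ T.content i.succ := fun h =>
    T.content_sub_ne_zero i (by rw [h, sub_self])
  have hz := zpow_ne_zpow hs hs1 hne
  have hab := stepCoeff_add_swap (s := s) (zpow_ne_zero (T.content i.castSucc) hs)
    (zpow_ne_zero (T.content i.succ) hs) hz
  have hp := exchangeCoeff_mul_neg hs hs1 hne
  have h1 := tableauHecke_single hs hs1 i T
  have h3 : tableauHecke s i (tableauHecke s i (Finsupp.single T 1)
      + stepCoeff s (s ^ T.content i.castSucc) (s ^ T.content i.succ) • Finsupp.single T 1)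
      + stepCoeff s (s ^ T.content i.succ) (s ^ T.content i.castSucc) •
        (tableauHecke s i (Finsupp.single T 1)
      + stepCoeff s (s ^ T.content i.castSucc) (s ^ T.content i.succ) • Finsupp.single T 1)
      = (s + stepCoeff s (s ^ T.content i.castSucc) (s ^ T.content i.succ)
          * stepCoeff s (s ^ T.content i.succ) (s ^ T.content i.castSucc))
          • Finsupp.single T 1 := by
    rw [h1, ← hp]
    rcases exchangeCoeff_eq_zero_or s T i with h0 | hR
    · rw [h0, zero_mul, zero_smul, map_zero, smul_zero, zero_smul, add_zero]
    · have h2 := tableauHecke_single hs hs1 i (T.adjSwap i)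
      rw [RST.content_adjSwap hR, RST.content_adjSwap hR, Equiv.swap_apply_left,
        Equiv.swap_apply_right, RST.adjSwap_adjSwap hR] at h2
      rw [map_smul, smul_comm, ← smul_add, h2, smul_smul]
  generalize stepCoeff s (s ^ T.content i.castSucc) (s ^ T.content i.succ) = α at *
  generalize stepCoeff s (s ^ T.content i.succ) (s ^ T.content i.castSucc) = β at *
  rw [map_add, map_smul] at h3
  linear_combination (norm := module) h3 - hab • tableauHecke s i (Finsupp.single T 1)

theorem tableauHecke_comm {s : K} (hs : s ≠ 0) (hs1 : ∀ b : ℤ, s ^ b = 1 → b = 0)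
    (i j : Fin n) (hij : (i : ℕ) + 1 < j) (u : RST n μ →₀ K) :
    tableauHecke s i (tableauHecke s j u) = tableauHecke s j (tableauHecke s i u) := by
  suffices h : tableauHecke s i ∘ₗ tableauHecke s j
      = tableauHecke s j ∘ₗ (tableauHecke s i : (RST n μ →₀ K) →ₗ[K] _) from
    LinearMap.congr_fun h u
  refine Finsupp.lhom_ext' fun T => LinearMap.ext_ring ?_
  simp only [LinearMap.comp_apply, Finsupp.lsingle_apply]
  have a1 : i.castSucc ≠ j.castSucc := by simp [Fin.ext_iff]; omega
  have a2 : i.castSucc ≠ j.succ := by simp [Fin.ext_iff]; omega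
  have a3 : i.succ ≠ j.castSucc := by simp [Fin.ext_iff]; omega
  have a4 : i.succ ≠ j.succ := by simp [Fin.ext_iff]; omega
  have hi := tableauHecke_single hs hs1 i T
  have hj := tableauHecke_single hs hs1 j T
  have hi' := tableauHecke_single hs hs1 i (T.adjSwap j)
  have hj' := tableauHecke_single hs hs1 j (T.adjSwap i)
  rw [RST.content_adjSwap_of_ne T j a1 a2, RST.content_adjSwap_of_ne T j a3 a4] at hi'
  rw [RST.content_adjSwap_of_ne T i a1.symm a3.symm,
    RST.content_adjSwap_of_ne T i a2.symm a4.symm] at hj'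
  set α := stepCoeff s (s ^ T.content i.castSucc) (s ^ T.content i.succ)
  set β := stepCoeff s (s ^ T.content j.castSucc) (s ^ T.content j.succ)
  set e := exchangeCoeff s (T.content i.succ - T.content i.castSucc)
  set f := exchangeCoeff s (T.content j.succ - T.content j.castSucc)
  have hT : (e * f) • Finsupp.single ((T.adjSwap j).adjSwap i) (1 : K)
      = (e * f) • Finsupp.single ((T.adjSwap i).adjSwap j) (1 : K) := by
    rcases exchangeCoeff_eq_zero_or s T i with h0 | hi0
    · simp only [e, h0, zero_mul, zero_smul]
    rcases exchangeCoeff_eq_zero_or s T j with h0 | hj0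
    · simp only [f, h0, mul_zero, zero_smul]
    have hi1 : ((T.adjSwap j).1.exchange i.castSucc i.succ).IsRST := by
      rw [RST.exchange_isRST_iff] at hi0 ⊢
      rwa [RST.content_adjSwap_of_ne T j a1 a2, RST.content_adjSwap_of_ne T j a3 a4]
    have hj1 : ((T.adjSwap i).1.exchange j.castSucc j.succ).IsRST := by
      rw [RST.exchange_isRST_iff] at hj0 ⊢
      rwa [RST.content_adjSwap_of_ne T i a1.symm a3.symm,
        RST.content_adjSwap_of_ne T i a2.symm a4.symm]
    congr 2
    refine RST.ext_content fun a => ?_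
    rw [RST.content_adjSwap hi1, RST.content_adjSwap hj0, RST.content_adjSwap hj1,
      RST.content_adjSwap hi0]
    congr 1
    simp only [Equiv.swap_apply_def]
    split_ifs <;> simp_all
  have h1 := congrArg (fun w => tableauHecke s i w + α • w) hj
  have h2 := congrArg (fun w => tableauHecke s j w + β • w) hi
  simp only [map_add, map_smul] at h1 h2
  linear_combination (norm := module) h1 - h2 + f • hi' - e • hj' + hT

theorem swap_braid (i j : Fin n) (hij : (i : ℕ) + 1 = j) (a : Fin (n + 1)) :
    Equiv.swap i.castSucc i.succ (Equiv.swap j.castSucc j.succ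
      (Equiv.swap i.castSucc i.succ a))
    = Equiv.swap j.castSucc j.succ (Equiv.swap i.castSucc i.succ
      (Equiv.swap j.castSucc j.succ a)) := by
  have e : j.castSucc = i.succ := by simp [Fin.ext_iff]; omega
  have a1 : i.castSucc ≠ i.succ := (Fin.castSucc_lt_succ (i := i)).ne
  have a2 : j.succ ≠ i.castSucc := by simp [Fin.ext_iff]; omega
  have a4 : j.succ ≠ i.succ := by simp [Fin.ext_iff]; omega
  rw [e]
  rcases eq_or_ne a i.castSucc with rfl | h1
  · rw [Equiv.swap_apply_left, Equiv.swap_apply_left, Equiv.swap_apply_of_ne_of_ne a2 a4,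
      Equiv.swap_apply_of_ne_of_ne a1 a2.symm, Equiv.swap_apply_left, Equiv.swap_apply_left]
  rcases eq_or_ne a i.succ with rfl | h2
  · rw [Equiv.swap_apply_right, Equiv.swap_apply_of_ne_of_ne a1 a2.symm, Equiv.swap_apply_left,
      Equiv.swap_apply_left, Equiv.swap_apply_of_ne_of_ne a2 a4, Equiv.swap_apply_right]
  rcases eq_or_ne a j.succ with rfl | h3
  · rw [Equiv.swap_apply_of_ne_of_ne a2 a4, Equiv.swap_apply_right, Equiv.swap_apply_right,
      Equiv.swap_apply_of_ne_of_ne a1 a2.symm]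
  · simp only [Equiv.swap_apply_of_ne_of_ne h1 h2, Equiv.swap_apply_of_ne_of_ne h2 h3]

/-- One side of the Yang-Baxter relation at a tableau, where `(c₁, c₂)`, `(c₃, c₄)` and `(c₅, c₆)`
are the contents of the letters exchanged by the three steps: the scalars multiply, and unless their
product vanishes all three exchanges take place, which determines the contents of the result. -/
theorem tableauHecke_three_steps {s : K} (hs : s ≠ 0) (hs1 : ∀ b : ℤ, s ^ b = 1 → b = 0)
    {i j : Fin n} (T : RST n μ)
    {c₁ c₂ c₃ c₄ c₅ c₆ : ℤ}
    (h1 : T.content i.castSucc = c₁) (h2 : T.content i.succ = c₂)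
    (h3 : (T.1.exchange i.castSucc i.succ).IsRST → (T.adjSwap i).content j.castSucc = c₃ ∧
      (T.adjSwap i).content j.succ = c₄)
    (h5 : (T.1.exchange i.castSucc i.succ).IsRST →
      ((T.adjSwap i).1.exchange j.castSucc j.succ).IsRST →
      ((T.adjSwap i).adjSwap j).content i.castSucc = c₅ ∧
        ((T.adjSwap i).adjSwap j).content i.succ = c₆)
    {A B : (RST n μ →₀ K) →ₗ[K] (RST n μ →₀ K)} (hA : A = tableauHecke s i)
    (hB : B = tableauHecke s j) {w : RST n μ →₀ K} (hw : w = Finsupp.single T 1)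
    {α β γ : K} (hα : α = stepCoeff s (s ^ c₁) (s ^ c₂)) (hβ : β = stepCoeff s (s ^ c₃) (s ^ c₄))
    (hγ : γ = stepCoeff s (s ^ c₅) (s ^ c₆)) :
    A (B (A w + α • w) + β • (A w + α • w)) + γ • (B (A w + α • w) + β • (A w + α • w))
      = (exchangeCoeff s (c₂ - c₁) * exchangeCoeff s (c₄ - c₃) * exchangeCoeff s (c₆ - c₅))
        • Finsupp.single (((T.adjSwap i).adjSwap j).adjSwap i) 1 ∧
    (exchangeCoeff s (c₂ - c₁) * exchangeCoeff s (c₄ - c₃) * exchangeCoeff s (c₆ - c₅) = 0 ∨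
      ∀ a, (((T.adjSwap i).adjSwap j).adjSwap i).content a
        = T.content (Equiv.swap i.castSucc i.succ (Equiv.swap j.castSucc j.succ
            (Equiv.swap i.castSucc i.succ a)))) := by
  subst hA hB hw hα hβ hγ
  have s1 := tableauHecke_single hs hs1 i T
  rw [h1, h2] at s1
  rw [s1]
  have d1 := exchangeCoeff_eq_zero_or s T i
  rw [h1, h2] at d1
  rcases d1 with d1 | d1
  · simp [d1]
  obtain ⟨h3, h4⟩ := h3 d1
  have s2 := tableauHecke_single hs hs1 j (T.adjSwap i)
  rw [h3, h4] at s2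
  rw [map_smul, smul_comm (stepCoeff _ _ _), ← smul_add, s2]
  have d2 := exchangeCoeff_eq_zero_or s (T.adjSwap i) j
  rw [h3, h4] at d2
  rcases d2 with d2 | d2
  · simp [d2]
  obtain ⟨h5, h6⟩ := h5 d1 d2
  have s3 := tableauHecke_single hs hs1 i ((T.adjSwap i).adjSwap j)
  rw [h5, h6] at s3
  rw [smul_smul, map_smul, smul_comm (stepCoeff _ _ _), ← smul_add, s3, smul_smul]
  refine ⟨rfl, ?_⟩
  have d3 := exchangeCoeff_eq_zero_or s ((T.adjSwap i).adjSwap j) i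
  rw [h5, h6] at d3
  rcases d3 with d3 | d3
  · simp [d3]
  exact Or.inr fun a => by
    rw [RST.content_adjSwap d3, RST.content_adjSwap d2, RST.content_adjSwap d1]

/-- Both sides of the Yang-Baxter relation at a tableau multiply the same tableau by the same
scalar, which yields the braid relation by `yangBaxter_sub`. -/
theorem tableauHecke_braid {s : K} (hs : s ≠ 0) (hs1 : ∀ b : ℤ, s ^ b = 1 → b = 0)
    (i j : Fin n) (hij : (i : ℕ) + 1 = j) (u : RST n μ →₀ K) :
    tableauHecke s i (tableauHecke s j (tableauHecke s i u))
      = tableauHecke s j (tableauHecke s i (tableauHecke s j u)) := by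
  suffices h : tableauHecke s i ∘ₗ tableauHecke s j ∘ₗ tableauHecke s i
      = tableauHecke s j ∘ₗ tableauHecke s i ∘ₗ
        (tableauHecke s j : (RST n μ →₀ K) →ₗ[K] _) from
    LinearMap.congr_fun h u
  refine Finsupp.lhom_ext' fun T => LinearMap.ext_ring ?_
  simp only [LinearMap.comp_apply, Finsupp.lsingle_apply]
  -- the spectral parameters of the letters `i`, `i + 1`, `i + 2` are `s ^ c₁`, `s ^ c₂`, `s ^ c₃`
  have e : i.succ = j.castSucc := by simp [Fin.ext_iff]; omega
  have a2 : j.succ ≠ i.castSucc := by simp [Fin.ext_iff]; omega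
  have a4 : j.succ ≠ i.succ := by simp [Fin.ext_iff]; omega
  have a1 : i.castSucc ≠ j.castSucc := by simp [Fin.ext_iff]; omega
  obtain ⟨c₁, hc₁⟩ : ∃ c, c = T.content i.castSucc := ⟨_, rfl⟩
  obtain ⟨c₂, hc₂⟩ : ∃ c, c = T.content i.succ := ⟨_, rfl⟩
  obtain ⟨c₃, hc₃⟩ : ∃ c, c = T.content j.succ := ⟨_, rfl⟩
  have n12 : c₁ ≠ c₂ := fun h => T.content_sub_ne_zero i (by omega)
  have n23 : c₂ ≠ c₃ := fun h => T.content_sub_ne_zero j (by rw [← e]; omega)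
  have n13 : c₁ ≠ c₃ := fun h => by
    have := T.2.add_three_le_of_content_eq (a := i.castSucc) (b := j.succ)
      (by rw [Fin.lt_def]; simp; omega) (by rw [hc₁, hc₃] at h; exact h)
    simp at this
    omega
  have A2 := Equiv.swap_apply_of_ne_of_ne a2 a4
  have B0 := Equiv.swap_apply_of_ne_of_ne a1 a2.symm
  have B1 : Equiv.swap j.castSucc j.succ i.succ = j.succ := by rw [e, Equiv.swap_apply_left]
  obtain ⟨hl, hl'⟩ := tableauHecke_three_steps hs hs1 (i := i) (j := j) T
    (c₁ := c₁) (c₂ := c₂) (c₃ := c₁) (c₄ := c₃) (c₅ := c₂) (c₆ := c₃) hc₁.symm hc₂.symm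
    (fun h => by
      simp only [RST.content_adjSwap h, ← e, Equiv.swap_apply_right, A2]
      exact ⟨hc₁.symm, hc₃.symm⟩)
    (fun h h' => by
      simp only [RST.content_adjSwap h', RST.content_adjSwap h, B0, B1, Equiv.swap_apply_left, A2]
      exact ⟨hc₂.symm, hc₃.symm⟩)
    rfl rfl rfl rfl rfl rfl
  obtain ⟨hr, hr'⟩ := tableauHecke_three_steps hs hs1 (i := j) (j := i) T
    (c₁ := c₂) (c₂ := c₃) (c₃ := c₁) (c₄ := c₃) (c₅ := c₁) (c₆ := c₂)
    (by rw [← e]; exact hc₂.symm) hc₃.symm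
    (fun h => by
      simp only [RST.content_adjSwap h, B0, B1]
      exact ⟨hc₁.symm, hc₃.symm⟩)
    (fun h h' => by
      simp only [RST.content_adjSwap h', RST.content_adjSwap h, ← e, Equiv.swap_apply_right, A2,
        e ▸ B0]
      exact ⟨hc₁.symm, hc₂.symm⟩)
    rfl rfl rfl rfl rfl rfl
  have hyb := yangBaxter_sub s (tableauHecke s i) (tableauHecke s j)
    (tableauHecke_quadratic hs hs1 i) (tableauHecke_quadratic hs hs1 j)
    (stepCoeff_triple (s := s) (zpow_ne_zero c₁ hs) (zpow_ne_zero c₂ hs)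
      (zpow_ne_zpow hs hs1 n12) (zpow_ne_zpow hs hs1 n13) (zpow_ne_zpow hs hs1 n23))
    (Finsupp.single T 1)
  rw [hl, hr] at hyb
  rw [← sub_eq_zero, ← hyb, sub_eq_zero]
  have hperm : exchangeCoeff s (c₃ - c₂) * exchangeCoeff s (c₃ - c₁) * exchangeCoeff s (c₂ - c₁)
      = exchangeCoeff s (c₂ - c₁) * exchangeCoeff s (c₃ - c₁) * exchangeCoeff s (c₃ - c₂) := by
    ring
  rw [hperm] at hr' ⊢
  rcases hl' with h0 | hl'
  · rw [h0, zero_smul, zero_smul]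
  rcases hr' with h0 | hr'
  · rw [h0, zero_smul, zero_smul]
  congr 2
  exact RST.ext_content fun a => by rw [hl', hr', swap_braid i j hij]

theorem heckeT_quadratic {s : K} (hs : s ≠ 0) (hs1 : ∀ b : ℤ, s ^ b = 1 → b = 0)
    (i : Fin n) (P : VecPoly K n μ) :
    heckeT s i (heckeT s i P) = (s - 1) • heckeT s i P + s • P :=
  heckeT_quadratic_of s i (tableauHecke_quadratic hs hs1 i) P

theorem heckeT_comm {s : K} (hs : s ≠ 0) (hs1 : ∀ b : ℤ, s ^ b = 1 → b = 0)
    (i j : Fin n) (hij : (i : ℕ) + 1 < j ∨ (j : ℕ) + 1 < i) (P : VecPoly K n μ) :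
    heckeT s i (heckeT s j P) = heckeT s j (heckeT s i P) := by
  rcases hij with h | h
  · exact heckeT_comm_of s i j h (tableauHecke_comm hs hs1 i j h) P
  · exact (heckeT_comm_of s j i h (tableauHecke_comm hs hs1 j i h) P).symm

theorem heckeT_braid {s : K} (hs : s ≠ 0) (hs1 : ∀ b : ℤ, s ^ b = 1 → b = 0)
    (i j : Fin n) (hij : (i : ℕ) + 1 = j) (P : VecPoly K n μ) :
    heckeT s i (heckeT s j (heckeT s i P)) = heckeT s j (heckeT s i (heckeT s j P)) :=
  heckeT_braid_of s i j hij (heckeT_quadratic hs hs1) (tableauHecke_braid hs hs1 i j hij) P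

/-! ### Commutation of the raising operator with the Hecke operators -/

section BraidProducts

variable {V : Type*} [AddCommGroup V] [Module K V]

/-- The composite applying `r 0` first, then `r 1`, and so on up to `r (k - 1)`. -/
def ascendingProd (r : ℕ → V →ₗ[K] V) : ℕ → V →ₗ[K] V
  | 0 => LinearMap.id
  | k + 1 => r k ∘ₗ ascendingProd r k

/-- `r k` is inverse to `t k`, and the `t k` with `k < n` satisfy the braid relations. -/
structure IsBraidAction (n : ℕ) (t r : ℕ → V →ₗ[K] V) : Prop where
  left_inv : ∀ k < n, ∀ u, r k (t k u) = u
  right_inv : ∀ k < n, ∀ u, t k (r k u) = u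
  comm : ∀ i j, i < n → j < n → (i + 1 < j ∨ j + 1 < i) → ∀ u, t i (t j u) = t j (t i u)
  braid : ∀ i, i + 1 < n → ∀ u, t i (t (i + 1) (t i u)) = t (i + 1) (t i (t (i + 1) u))

namespace IsBraidAction

variable {t r : ℕ → V →ₗ[K] V} (H : IsBraidAction n t r)
include H

theorem comm_inv {i j : ℕ} (hi : i < n) (hj : j < n) (hij : i + 1 < j ∨ j + 1 < i) (u : V) :
    t i (r j u) = r j (t i u) := by
  rw [← H.left_inv j hj (t i (r j u)), ← H.comm i j hi hj hij, H.right_inv j hj]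

theorem descend {j : ℕ} (hj : j + 1 < n) (u : V) :
    r (j + 1) (r j (t (j + 1) u)) = t j (r (j + 1) (r j u)) := by
  have h := H.braid j hj (r (j + 1) (r j u))
  rw [H.right_inv _ hj, H.right_inv _ (by omega)] at h
  rw [← h, H.left_inv _ (by omega), H.left_inv _ hj]

theorem ascend {j : ℕ} (hj : j + 1 < n) (u : V) :
    r j (r (j + 1) (t j u)) = t (j + 1) (r j (r (j + 1) u)) := by
  have h := H.braid j hj (r j (r (j + 1) u))
  rw [H.right_inv _ (by omega), H.right_inv _ hj] at h
  rw [h, H.left_inv _ hj, H.left_inv _ (by omega)]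

theorem prod_comm {k m : ℕ} (hk : k < m) (hm : m < n) (u : V) :
    ascendingProd r k (t m u) = t m (ascendingProd r k u) := by
  induction k with
  | zero => rfl
  | succ k ih =>
    change r k (ascendingProd r k (t m u)) = t m (r k (ascendingProd r k u))
    rw [ih (by omega), H.comm_inv hm (by omega) (Or.inr hk)]

theorem prod_comm_inv {k m : ℕ} (hk : k < m) (hm : m < n) (u : V) :
    ascendingProd r k (r m u) = r m (ascendingProd r k u) := by
  rw [← H.left_inv m hm (ascendingProd r k (r m u)), ← H.prod_comm hk hm, H.right_inv m hm]

theorem prod_descend {j k : ℕ} (hj : j + 1 < k) (hk : k ≤ n) (u : V) :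
    ascendingProd r k (t (j + 1) u) = t j (ascendingProd r k u) := by
  induction k with
  | zero => omega
  | succ k ih =>
    change r k (ascendingProd r k (t (j + 1) u)) = t j (r k (ascendingProd r k u))
    rcases (Nat.lt_succ_iff.1 hj).lt_or_eq with h | rfl
    · rw [ih h (by omega), H.comm_inv (by omega) (by omega) (Or.inl h)]
    · change r (j + 1) (r j (ascendingProd r j (t (j + 1) u)))
        = t j (r (j + 1) (r j (ascendingProd r j u)))
      rw [H.prod_comm (by omega) (by omega), H.descend (by omega)]

theorem prod_prod_ascend {k : ℕ} (hk : k < n) (u : V) :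
    ascendingProd r k (ascendingProd r (k + 1) (t 0 u))
      = t k (ascendingProd r k (ascendingProd r (k + 1) u)) := by
  induction k with
  | zero =>
    change r 0 (t 0 u) = t 0 (r 0 u)
    rw [H.left_inv 0 hk, H.right_inv 0 hk]
  | succ k ih =>
    have e : ∀ w, ascendingProd r (k + 1) (ascendingProd r (k + 2) w)
        = r k (r (k + 1) (ascendingProd r k (ascendingProd r (k + 1) w))) := fun w => by
      rw [← H.prod_comm_inv (by omega) hk]
      rfl
    rw [e, e, ih (by omega), H.ascend hk]

end IsBraidAction

theorem foldl_finRange_eq_ascendingProd (r : ℕ → V →ₗ[K] V) (m : ℕ) (u : V) :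
    (List.finRange m).foldl (fun R (i : Fin m) => r i R) u = ascendingProd r m u := by
  rw [← List.foldl_map (f := Fin.val) (g := fun R k => r k R), List.map_coe_finRange_eq_range]
  induction m with
  | zero => rfl
  | succ m ih =>
    rw [List.range_succ, List.foldl_append, ih]
    rfl

end BraidProducts

section Raising

variable {s : K}

theorem heckeTInv_apply (s : K) (i : Fin n) (P : VecPoly K n μ) :
    heckeTInv s i P = s⁻¹ • (heckeT s i P + (1 - s) • P) := rfl

theorem heckeTInv_heckeT (hs : s ≠ 0) (hs1 : ∀ b : ℤ, s ^ b = 1 → b = 0) (i : Fin n)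
    (P : VecPoly K n μ) : heckeTInv s i (heckeT s i P) = P := by
  rw [heckeTInv_apply, heckeT_quadratic hs hs1, inv_smul_eq_iff₀ hs]
  module

theorem heckeT_heckeTInv (hs : s ≠ 0) (hs1 : ∀ b : ℤ, s ^ b = 1 → b = 0) (i : Fin n)
    (P : VecPoly K n μ) : heckeT s i (heckeTInv s i P) = P := by
  rw [heckeTInv_apply, map_smul, map_add, map_smul, heckeT_quadratic hs hs1, inv_smul_eq_iff₀ hs]
  module

/-- The operators `T_i` indexed by all natural numbers (with the identity for `i ≥ n`). -/
def natHecke (s : K) (k : ℕ) : VecPoly K n μ →ₗ[K] VecPoly K n μ :=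
  if h : k < n then heckeT s ⟨k, h⟩ else LinearMap.id

/-- The inverses of the operators `T_i`, indexed by all natural numbers. -/
def natHeckeInv (s : K) (k : ℕ) : VecPoly K n μ →ₗ[K] VecPoly K n μ :=
  if h : k < n then heckeTInv s ⟨k, h⟩ else LinearMap.id

theorem natHecke_coe (s : K) (i : Fin n) :
    (natHecke s i : VecPoly K n μ →ₗ[K] VecPoly K n μ) = heckeT s i := dif_pos i.2

theorem natHeckeInv_coe (s : K) (i : Fin n) :
    (natHeckeInv s i : VecPoly K n μ →ₗ[K] VecPoly K n μ) = heckeTInv s i := dif_pos i.2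

theorem isBraidAction_natHecke (hs : s ≠ 0) (hs1 : ∀ b : ℤ, s ^ b = 1 → b = 0) :
    IsBraidAction (K := K) (V := VecPoly K n μ) n (natHecke s) (natHeckeInv s) where
  left_inv k hk u := by
    rw [natHecke, natHeckeInv, dif_pos hk, dif_pos hk, heckeTInv_heckeT hs hs1]
  right_inv k hk u := by
    rw [natHecke, natHeckeInv, dif_pos hk, dif_pos hk, heckeT_heckeTInv hs hs1]
  comm i j hi hj hij u := by
    rw [natHecke, natHecke, dif_pos hi, dif_pos hj]
    exact heckeT_comm hs hs1 _ _ hij u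
  braid i hi u := by
    rw [natHecke, natHecke, dif_pos (by omega), dif_pos hi]
    exact heckeT_braid hs hs1 _ _ rfl u

theorem raising_eq (s : K) (P : VecPoly K n μ) :
    raising s P = xmul (Fin.last n) (ascendingProd (natHeckeInv s) n P) := by
  rw [← foldl_finRange_eq_ascendingProd]
  simp only [natHeckeInv_coe]
  rfl

theorem raising_add (s : K) (P Q : VecPoly K n μ) :
    raising s (P + Q) = raising s P + raising s Q := by
  simp only [raising_eq, map_add]

theorem raising_smul (s c : K) (P : VecPoly K n μ) :
    raising s (c • P) = c • raising s P := by
  simp only [raising_eq, map_smul]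

/-- `T_{i+1} Φ = Φ T_i`, in the notation of operators acting on the right. -/
theorem raising_heckeT (hs : s ≠ 0) (hs1 : ∀ b : ℤ, s ^ b = 1 → b = 0) {j k : Fin n}
    (hjk : (j : ℕ) + 1 = k) (P : VecPoly K n μ) :
    raising s (heckeT s k P) = heckeT s j (raising s P) := by
  have hk := k.2
  rw [raising_eq, raising_eq, ← natHecke_coe s k, ← hjk,
    (isBraidAction_natHecke hs hs1).prod_descend (by omega) le_rfl, natHecke_coe,
    heckeT_xmul_of_ne]
  · simp [Fin.ext_iff]; omega
  · simp [Fin.ext_iff]; omega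

theorem xmul_succ_heckeTInv (s : K) (i : Fin n) (P : VecPoly K n μ) :
    xmul i.succ (heckeTInv s i P) = s⁻¹ • heckeT s i (xmul i.castSucc P) := by
  rw [heckeTInv_apply, heckeT_xmul_castSucc, map_smul, map_add, map_smul]

theorem heckeT_xmul_xmul (s : K) (i : Fin n) (P : VecPoly K n μ) :
    heckeT s i (xmul i.castSucc (xmul i.succ P))
      = xmul i.castSucc (xmul i.succ (heckeT s i P)) := by
  rw [heckeT_xmul_castSucc, heckeT_xmul_succ, map_sub, map_smul, sub_add_cancel, xmul_comm]

theorem ascendingProd_xmul_last (s : K) {k : ℕ} (hk : k < n) (P : VecPoly K n μ) :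
    ascendingProd (natHeckeInv s) k (xmul (Fin.last n) P)
      = xmul (Fin.last n) (ascendingProd (natHeckeInv s) k P) := by
  induction k with
  | zero => rfl
  | succ k ih =>
    change natHeckeInv s k (ascendingProd (natHeckeInv s) k (xmul (Fin.last n) P))
      = xmul (Fin.last n) (natHeckeInv s k (ascendingProd (natHeckeInv s) k P))
    rw [ih (by omega), natHeckeInv, dif_pos (by omega), heckeTInv_apply, heckeTInv_apply,
      heckeT_xmul_of_ne, map_smul, map_add, map_smul]
    · simp [Fin.ext_iff]; omega
    · simp [Fin.ext_iff]; omega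

/-- `T_1 Φ² = Φ² T_{N-1}`, in the notation of operators acting on the right. The braid relations
take `T_1` through the two products of inverses, and `x_{N-1} x_N` commutes with `T_{N-1}`. -/
theorem raising_raising_heckeT (hs : s ≠ 0) (hs1 : ∀ b : ℤ, s ^ b = 1 → b = 0) {j k : Fin n}
    (hj : (j : ℕ) = 0) (hk : (k : ℕ) + 1 = n) (P : VecPoly K n μ) :
    raising s (raising s (heckeT s j P)) = heckeT s k (raising s (raising s P)) := by
  have hlast : Fin.last n = k.succ := by simp [Fin.ext_iff]; omega
  have e : ∀ Q : VecPoly K n μ, raising s (raising s Q) = xmul k.succ (heckeTInv s k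
      (xmul k.succ (ascendingProd (natHeckeInv s) k
        (ascendingProd (natHeckeInv s) (k + 1) Q)))) := fun Q => by
    rw [← natHeckeInv_coe, ← hlast, ← ascendingProd_xmul_last s k.2, raising_eq, raising_eq, hk]
    change _ = xmul (Fin.last n) (ascendingProd (natHeckeInv s) (k + 1) _)
    rw [hk]
  rw [e, e, ← natHecke_coe s j, hj, (isBraidAction_natHecke hs hs1).prod_prod_ascend k.2,
    natHecke_coe, xmul_succ_heckeTInv s, xmul_succ_heckeTInv s, ← heckeT_xmul_xmul, map_smul]

end Raising

/-! ### Exchanges and rotations of vectors -/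

section Vectors

variable {α : Type*}

theorem vecSwap_castSucc (i : Fin n) (u : Fin (n + 1) → α) :
    vecSwap i u i.castSucc = u i.succ := by
  rw [vecSwap, Function.comp_apply, Equiv.swap_apply_left]

theorem vecSwap_succ (i : Fin n) (u : Fin (n + 1) → α) :
    vecSwap i u i.succ = u i.castSucc := by
  rw [vecSwap, Function.comp_apply, Equiv.swap_apply_right]

theorem vecSwap_of_ne (i : Fin n) (u : Fin (n + 1) → α) {a : Fin (n + 1)}
    (h1 : a ≠ i.castSucc) (h2 : a ≠ i.succ) : vecSwap i u a = u a := by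
  rw [vecSwap, Function.comp_apply, Equiv.swap_apply_of_ne_of_ne h1 h2]

theorem vecSwap_vecSwap (i : Fin n) (u : Fin (n + 1) → α) : vecSwap i (vecSwap i u) = u := by
  funext a
  simp [vecSwap]

theorem castSucc_ne_succ_of_far {i j : Fin n} (hij : (i : ℕ) + 1 < j ∨ (j : ℕ) + 1 < i) :
    i.castSucc ≠ j.castSucc ∧ i.castSucc ≠ j.succ ∧ i.succ ≠ j.castSucc ∧ i.succ ≠ j.succ := by
  simp only [ne_eq, Fin.ext_iff, Fin.val_castSucc, Fin.val_succ]
  omega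

theorem vecSwap_comm {i j : Fin n} (hij : (i : ℕ) + 1 < j ∨ (j : ℕ) + 1 < i)
    (u : Fin (n + 1) → α) : vecSwap i (vecSwap j u) = vecSwap j (vecSwap i u) := by
  obtain ⟨a1, a2, a3, a4⟩ := castSucc_ne_succ_of_far hij
  funext a
  rcases eq_or_ne a i.castSucc with rfl | h1
  · rw [vecSwap_castSucc, vecSwap_of_ne j _ a1 a2, vecSwap_of_ne j _ a3 a4, vecSwap_castSucc]
  rcases eq_or_ne a i.succ with rfl | h2
  · rw [vecSwap_succ, vecSwap_of_ne j _ a1 a2, vecSwap_of_ne j _ a3 a4, vecSwap_succ]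
  rcases eq_or_ne a j.castSucc with rfl | h3
  · rw [vecSwap_castSucc, vecSwap_of_ne i _ h1 h2, vecSwap_of_ne i _ a2.symm a4.symm,
      vecSwap_castSucc]
  rcases eq_or_ne a j.succ with rfl | h4
  · rw [vecSwap_succ, vecSwap_of_ne i _ h1 h2, vecSwap_of_ne i _ a1.symm a3.symm, vecSwap_succ]
  · rw [vecSwap_of_ne i _ h1 h2, vecSwap_of_ne j _ h3 h4, vecSwap_of_ne j _ h3 h4,
      vecSwap_of_ne i _ h1 h2]

theorem vecSwap_braid {i j : Fin n} (hij : (i : ℕ) + 1 = j) (u : Fin (n + 1) → α) :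
    vecSwap i (vecSwap j (vecSwap i u)) = vecSwap j (vecSwap i (vecSwap j u)) := by
  funext a
  exact congrArg u (swap_braid i j hij a)

theorem vecRotate_castSucc (g : α → α) (u : Fin (n + 1) → α) (j : Fin n) :
    vecRotate g u j.castSucc = u j.succ :=
  Fin.snoc_castSucc (α := fun _ => α) _ _ _

theorem vecRotate_last (g : α → α) (u : Fin (n + 1) → α) :
    vecRotate g u (Fin.last n) = g (u 0) :=
  Fin.snoc_last (α := fun _ => α) _ _

theorem vecRotate_vecSwap (g : α → α) {i k : Fin n} (hik : (i : ℕ) + 1 = k)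
    (u : Fin (n + 1) → α) : vecRotate g (vecSwap k u) = vecSwap i (vecRotate g u) := by
  have e : i.succ = k.castSucc := by simp [Fin.ext_iff]; omega
  have hk := k.2
  funext x
  induction x using Fin.lastCases with
  | last =>
    rw [vecRotate_last, vecSwap_of_ne, vecSwap_of_ne, vecRotate_last] <;>
    simp only [ne_eq, Fin.ext_iff, Fin.val_castSucc, Fin.val_succ, Fin.val_last,
      Fin.val_zero] <;> omega
  | cast j =>
    rw [vecRotate_castSucc]
    rcases eq_or_ne j i with rfl | h1
    · rw [vecSwap_castSucc, e, vecSwap_castSucc, vecRotate_castSucc]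
    rcases eq_or_ne j k with rfl | h2
    · rw [vecSwap_succ, ← e, vecSwap_succ, vecRotate_castSucc]
    · rw [vecSwap_of_ne, vecSwap_of_ne, vecRotate_castSucc] <;>
      simp only [ne_eq, Fin.ext_iff, Fin.val_castSucc, Fin.val_succ] at h1 h2 ⊢ <;> omega

theorem vecRotate_vecRotate_vecSwap (g : α → α) {j k : Fin n} (hj : (j : ℕ) = 0)
    (hk : (k : ℕ) + 1 = n) (u : Fin (n + 1) → α) :
    vecRotate g (vecRotate g (vecSwap j u)) = vecSwap k (vecRotate g (vecRotate g u)) := by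
  have e0 : (0 : Fin (n + 1)) = j.castSucc := by simp [Fin.ext_iff]; omega
  have el : k.succ = Fin.last n := by simp [Fin.ext_iff]; omega
  funext x
  induction x using Fin.lastCases with
  | last =>
    rw [vecRotate_last, e0, vecRotate_castSucc, vecSwap_succ, ← el, vecSwap_succ,
      vecRotate_castSucc, el, vecRotate_last, e0]
  | cast m =>
    rw [vecRotate_castSucc]
    rcases eq_or_ne m k with rfl | h1
    · rw [vecSwap_castSucc, el, vecRotate_last, vecRotate_last, e0, vecSwap_castSucc,
        vecRotate_castSucc]
    · have hm : (m : ℕ) + 1 < n := by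
        have := m.2
        have : (m : ℕ) ≠ k := fun h => h1 (Fin.ext h)
        omega
      have em : m.succ = (⟨m + 1, hm⟩ : Fin n).castSucc := by simp [Fin.ext_iff]
      rw [vecSwap_of_ne, vecRotate_castSucc, em, vecRotate_castSucc, vecRotate_castSucc,
        vecSwap_of_ne] <;>
      simp only [ne_eq, Fin.ext_iff, Fin.val_castSucc, Fin.val_succ] at h1 ⊢ <;> omega

end Vectors

/-! ### The rank function -/

/-- `j` precedes `i` in the order that sorts the entries of `v` decreasingly, equal entries from
left to right. -/
def Precedes (v : Fin (n + 1) → ℕ) (j i : Fin (n + 1)) : Prop :=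
  (j < i ∧ v i ≤ v j) ∨ (i < j ∧ v i < v j)

open Classical in
theorem val_rankFun (v : Fin (n + 1) → ℕ) (i : Fin (n + 1)) :
    (rankFun v i : ℕ) = (Finset.univ.filter fun j => Precedes v j i).card := by
  simp only [rankFun, Precedes]
  congr

theorem rankFun_lt {v : Fin (n + 1) → ℕ} {i j : Fin (n + 1)} (h : Precedes v j i) :
    rankFun v j < rankFun v i := by
  classical
  rw [Fin.lt_def, val_rankFun, val_rankFun]
  refine Finset.card_lt_card ((Finset.ssubset_iff_of_subset fun k hk => ?_).2 ⟨j, ?_, ?_⟩)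
  · rw [Finset.mem_filter] at hk ⊢
    refine ⟨hk.1, ?_⟩
    have hk := hk.2
    rcases eq_or_ne k i with rfl | hki
    · simp only [Precedes, Fin.lt_def] at hk h
      omega
    · simp only [Precedes, Fin.lt_def, ne_eq, Fin.ext_iff] at hk h hki ⊢
      omega
  · simpa using h
  · intro hj
    have := (Finset.mem_filter.1 hj).2
    simp [Precedes] at this

theorem rankFun_injective (v : Fin (n + 1) → ℕ) : Function.Injective (rankFun v) := by
  intro i j hij
  by_contra hne
  have : Precedes v i j ∨ Precedes v j i := by
    have : (i : ℕ) ≠ j := fun h => hne (Fin.ext h)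
    simp only [Precedes, Fin.lt_def]
    omega
  rcases this with h | h
  · exact (rankFun_lt h).ne hij
  · exact (rankFun_lt h).ne' hij

theorem rankFun_surjective (v : Fin (n + 1) → ℕ) : Function.Surjective (rankFun v) :=
  Finite.surjective_of_injective (rankFun_injective v)

theorem rankFun_zero (i : Fin (n + 1)) : rankFun (fun _ => 0) i = i := by
  classical
  refine Fin.ext ?_
  rw [val_rankFun]
  have : (Finset.univ.filter fun j => Precedes (fun _ => 0) j i) = Finset.Iio i := by
    ext j
    simp [Precedes]
  rw [this, Fin.card_Iio]

theorem rankFun_succ_of_eq {v : Fin (n + 1) → ℕ} {i : Fin n} (h : v i.castSucc = v i.succ) :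
    (rankFun v i.succ : ℕ) = rankFun v i.castSucc + 1 := by
  classical
  rw [val_rankFun, val_rankFun]
  have : (Finset.univ.filter fun j => Precedes v j i.succ)
      = insert i.castSucc (Finset.univ.filter fun j => Precedes v j i.castSucc) := by
    ext j
    simp only [Finset.mem_filter, Finset.mem_univ, true_and, Finset.mem_insert]
    rcases eq_or_ne j i.castSucc with rfl | h1
    · simp [Precedes, h]
    rcases eq_or_ne j i.succ with rfl | h2
    · simp [Precedes, h, Fin.ext_iff, Fin.le_def]
    · simp only [Precedes, Fin.lt_def, Fin.ext_iff, ne_eq, Fin.val_castSucc, Fin.val_succ, h]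
        at h1 h2 ⊢
      omega
  rw [this, Finset.card_insert_of_notMem]
  intro hi
  have := (Finset.mem_filter.1 hi).2
  simp [Precedes] at this

theorem exists_rankFun_eq {v : Fin (n + 1) → ℕ} {i : Fin n} (h : v i.castSucc = v i.succ) :
    ∃ k : Fin n, rankFun v i.castSucc = k.castSucc ∧ rankFun v i.succ = k.succ := by
  have h1 := rankFun_succ_of_eq h
  have h2 := (rankFun v i.succ).2
  exact ⟨⟨rankFun v i.castSucc, by omega⟩, Fin.ext rfl, Fin.ext (by simpa using h1)⟩

/-- Ranks are transported by permutations of the positions that respect the sorting order. -/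
theorem rankFun_eq_of_precedes_iff {v w : Fin (n + 1) → ℕ} (σ : Equiv.Perm (Fin (n + 1)))
    {i : Fin (n + 1)} (h : ∀ j, Precedes w j i ↔ Precedes v (σ j) (σ i)) :
    rankFun w i = rankFun v (σ i) := by
  classical
  refine Fin.ext ?_
  rw [val_rankFun, val_rankFun]
  exact Finset.card_equiv σ fun j => by simp [h]

theorem rankFun_vecSwap {v : Fin (n + 1) → ℕ} {i : Fin n} (h : v i.castSucc ≠ v i.succ) :
    rankFun (vecSwap i v) = vecSwap i (rankFun v) := by
  funext x
  refine rankFun_eq_of_precedes_iff (Equiv.swap i.castSucc i.succ) fun j => ?_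
  rcases eq_or_ne x i.castSucc with rfl | h1
  · rw [Equiv.swap_apply_left]
    rcases eq_or_ne j i.castSucc with rfl | h3
    · simp [Precedes]
    rcases eq_or_ne j i.succ with rfl | h4
    · rw [Equiv.swap_apply_right]
      simp only [Precedes, vecSwap_castSucc, vecSwap_succ, Fin.lt_def, Fin.val_castSucc,
        Fin.val_succ]
      omega
    · rw [Equiv.swap_apply_of_ne_of_ne h3 h4]
      simp only [Precedes, vecSwap_castSucc, vecSwap_of_ne i v h3 h4, Fin.lt_def,
        Fin.val_castSucc, Fin.val_succ, ne_eq, Fin.ext_iff] at h3 h4 ⊢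
      omega
  rcases eq_or_ne x i.succ with rfl | h2
  · rw [Equiv.swap_apply_right]
    rcases eq_or_ne j i.castSucc with rfl | h3
    · rw [Equiv.swap_apply_left]
      simp only [Precedes, vecSwap_castSucc, vecSwap_succ, Fin.lt_def, Fin.val_castSucc,
        Fin.val_succ]
      omega
    rcases eq_or_ne j i.succ with rfl | h4
    · simp [Precedes]
    · rw [Equiv.swap_apply_of_ne_of_ne h3 h4]
      simp only [Precedes, vecSwap_succ, vecSwap_of_ne i v h3 h4, Fin.lt_def,
        Fin.val_castSucc, Fin.val_succ, ne_eq, Fin.ext_iff] at h3 h4 ⊢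
      omega
  · rw [Equiv.swap_apply_of_ne_of_ne h1 h2]
    rcases eq_or_ne j i.castSucc with rfl | h3
    · rw [Equiv.swap_apply_left]
      simp only [Precedes, vecSwap_castSucc, vecSwap_of_ne i v h1 h2, Fin.lt_def,
        Fin.val_castSucc, Fin.val_succ, ne_eq, Fin.ext_iff] at h1 h2 ⊢
      omega
    rcases eq_or_ne j i.succ with rfl | h4
    · rw [Equiv.swap_apply_right]
      simp only [Precedes, vecSwap_succ, vecSwap_of_ne i v h1 h2, Fin.lt_def,
        Fin.val_castSucc, Fin.val_succ, ne_eq, Fin.ext_iff] at h1 h2 ⊢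
      omega
    · rw [Equiv.swap_apply_of_ne_of_ne h3 h4]
      simp only [Precedes, vecSwap_of_ne i v h1 h2, vecSwap_of_ne i v h3 h4]

theorem rankFun_vecRotate (v : Fin (n + 1) → ℕ) :
    rankFun (vecRotate (fun k => k + 1) v) = vecRotate id (rankFun v) := by
  have hσ : ∀ j : Fin n, finRotate (n + 1) j.castSucc = j.succ := fun j => by
    rw [finRotate_apply]
    exact Fin.coeSucc_eq_succ
  have hl : finRotate (n + 1) (Fin.last n) = 0 := finRotate_last
  have key : ∀ x, rankFun (vecRotate (fun k => k + 1) v) x = rankFun v (finRotate (n + 1) x) := by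
    intro x
    refine rankFun_eq_of_precedes_iff (finRotate (n + 1)) fun j => ?_
    induction x using Fin.lastCases with
    | last =>
      induction j using Fin.lastCases with
      | last => simp [Precedes]
      | cast j =>
        rw [hσ, hl]
        simp [Precedes, vecRotate_castSucc, vecRotate_last, (Fin.castSucc_lt_last j).not_gt]
    | cast x =>
      induction j using Fin.lastCases with
      | last =>
        rw [hσ, hl]
        simp [Precedes, vecRotate_castSucc, vecRotate_last, (Fin.castSucc_lt_last x).not_gt,
          Fin.castSucc_lt_last]
      | cast j =>
        rw [hσ, hσ]
        simp [Precedes, vecRotate_castSucc]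
  funext x
  rw [key]
  induction x using Fin.lastCases with
  | last => rw [hl, vecRotate_last, id]
  | cast x => rw [hσ, vecRotate_castSucc]

/-! ### Spectral vectors -/

theorem exponents_unique {q s : K} (hq : q ≠ 0) (hs : s ≠ 0)
    (hqs : ∀ a b : ℤ, q ^ a * s ^ b = 1 → a = 0 ∧ b = 0) {a b c d : ℤ}
    (h : q ^ a * s ^ b = q ^ c * s ^ d) : a = c ∧ b = d := by
  have := hqs (a - c) (b - d) (by
    have h1 : q ^ c ≠ 0 := zpow_ne_zero _ hq
    have h2 : s ^ d ≠ 0 := zpow_ne_zero _ hs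
    rw [zpow_sub₀ hq, zpow_sub₀ hs, div_mul_div_comm, h, div_self (mul_ne_zero h1 h2)])
  omega

theorem spectralVector_eq (q s : K) (v : Fin (n + 1) → ℕ) (T : RST n μ) (i : Fin (n + 1)) :
    spectralVector q s v T i = q ^ (v i : ℤ) * s ^ T.content (rankFun v i) := by
  rw [zpow_natCast]
  rfl

theorem spectralVector_ne_zero {q s : K} (hq : q ≠ 0) (hs : s ≠ 0) (v : Fin (n + 1) → ℕ)
    (T : RST n μ) (i : Fin (n + 1)) : spectralVector q s v T i ≠ 0 :=
  mul_ne_zero (pow_ne_zero _ hq) (zpow_ne_zero _ hs)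

/-- The exponents of `q` give `v`, and those of `s` give the contents of all letters of `T`. -/
theorem spectralVector_injective {q s : K} (hq : q ≠ 0) (hs : s ≠ 0)
    (hqs : ∀ a b : ℤ, q ^ a * s ^ b = 1 → a = 0 ∧ b = 0) {v w : Fin (n + 1) → ℕ}
    {T U : RST n μ} (h : spectralVector q s v T = spectralVector q s w U) : v = w ∧ T = U := by
  have h1 : ∀ i, v i = w i ∧ T.content (rankFun v i) = U.content (rankFun w i) := fun i => by
    have := congrFun h i
    rw [spectralVector_eq, spectralVector_eq] at this
    have := exponents_unique hq hs hqs this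
    omega
  have hvw : v = w := funext fun i => (h1 i).1
  subst hvw
  refine ⟨rfl, RST.ext_content fun a => ?_⟩
  obtain ⟨i, rfl⟩ := rankFun_surjective v a
  exact (h1 i).2

theorem spectralVector_vecSwap (q s : K) {v : Fin (n + 1) → ℕ} (T : RST n μ) {i : Fin n}
    (h : v i.castSucc ≠ v i.succ) :
    spectralVector q s (vecSwap i v) T = vecSwap i (spectralVector q s v T) := by
  funext a
  rw [spectralVector_eq, rankFun_vecSwap h]
  simp only [vecSwap, Function.comp_apply, spectralVector_eq]

theorem spectralVector_vecRotate (q s : K) (v : Fin (n + 1) → ℕ) (T : RST n μ) :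
    spectralVector q s (vecRotate (fun k => k + 1) v) T
      = vecRotate (fun z => q * z) (spectralVector q s v T) := by
  funext a
  rw [spectralVector, rankFun_vecRotate]
  induction a using Fin.lastCases with
  | last => rw [vecRotate_last, vecRotate_last, vecRotate_last, id, pow_succ', mul_assoc,
      spectralVector]
  | cast a => rw [vecRotate_castSucc, vecRotate_castSucc, vecRotate_castSucc, spectralVector]

theorem spectralVector_adjSwap (q s : K) {v : Fin (n + 1) → ℕ} {T : RST n μ} {i k : Fin n}
    (h : v i.castSucc = v i.succ) (hk : rankFun v i.castSucc = k.castSucc)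
    (hT : (T.1.exchange k.castSucc k.succ).IsRST) :
    spectralVector q s v (T.adjSwap k) = vecSwap i (spectralVector q s v T) := by
  have hk' : rankFun v i.succ = k.succ := Fin.ext (by
    rw [rankFun_succ_of_eq h, hk]; rfl)
  funext a
  rcases eq_or_ne a i.castSucc with rfl | h1
  · rw [vecSwap_castSucc, spectralVector_eq, spectralVector_eq, hk, hk', RST.content_adjSwap hT,
      Equiv.swap_apply_left, h]
  rcases eq_or_ne a i.succ with rfl | h2
  · rw [vecSwap_succ, spectralVector_eq, spectralVector_eq, hk, hk', RST.content_adjSwap hT,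
      Equiv.swap_apply_right, h]
  · rw [vecSwap_of_ne _ _ h1 h2, spectralVector_eq, spectralVector_eq, RST.content_adjSwap_of_ne]
    · rw [← hk]; exact fun h => h1 (rankFun_injective v h)
    · rw [← hk']; exact fun h => h2 (rankFun_injective v h)

theorem spectralVector_ne_of_ne {q s : K} (hq : q ≠ 0) (hs : s ≠ 0)
    (hqs : ∀ a b : ℤ, q ^ a * s ^ b = 1 → a = 0 ∧ b = 0) {v : Fin (n + 1) → ℕ}
    {T : RST n μ} {a b : Fin (n + 1)} (h : v a ≠ v b) :
    spectralVector q s v T a ≠ spectralVector q s v T b := fun he => by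
  rw [spectralVector_eq, spectralVector_eq] at he
  have := (exponents_unique hq hs hqs he).1
  omega

theorem spectralVector_castSucc_ne_succ {q s : K} (hq : q ≠ 0) (hs : s ≠ 0)
    (hqs : ∀ a b : ℤ, q ^ a * s ^ b = 1 → a = 0 ∧ b = 0) (v : Fin (n + 1) → ℕ)
    (T : RST n μ) (i : Fin n) :
    spectralVector q s v T i.castSucc ≠ spectralVector q s v T i.succ := fun he => by
  by_cases h : v i.castSucc = v i.succ
  · rw [spectralVector_eq, spectralVector_eq] at he
    have h2 := (exponents_unique hq hs hqs he).2
    obtain ⟨k, hk, hk'⟩ := exists_rankFun_eq h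
    rw [hk, hk'] at h2
    exact T.content_sub_ne_zero k (by rw [h2, sub_self])
  · exact spectralVector_ne_of_ne hq hs hqs h he

/-! ### Yang-Baxter steps -/

/-- The step `P ↦ P (T_i + (1 - s) / (1 - ζ_{i+1} / ζ_i))`. -/
def ybStep (s : K) (ζ : Fin (n + 1) → K) (i : Fin n) (P : VecPoly K n μ) : VecPoly K n μ :=
  heckeT s i P + stepCoeff s (ζ i.castSucc) (ζ i.succ) • P

theorem ybStep_smul (s : K) (ζ : Fin (n + 1) → K) (i : Fin n) (c : K) (P : VecPoly K n μ) :
    ybStep s ζ i (c • P) = c • ybStep s ζ i P := by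
  rw [ybStep, ybStep, map_smul, smul_add, smul_comm c]

section Steps

variable {s : K} (hs : s ≠ 0) (hs1 : ∀ b : ℤ, s ^ b = 1 → b = 0)
include hs hs1

theorem ybStep_comm {i j : Fin n} (hij : (i : ℕ) + 1 < j ∨ (j : ℕ) + 1 < i)
    (ζ : Fin (n + 1) → K) (P : VecPoly K n μ) :
    ybStep s (vecSwap j ζ) i (ybStep s ζ j P) = ybStep s (vecSwap i ζ) j (ybStep s ζ i P) := by
  obtain ⟨a1, a2, a3, a4⟩ := castSucc_ne_succ_of_far hij
  simp only [ybStep, vecSwap_of_ne j ζ a1 a2, vecSwap_of_ne j ζ a3 a4,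
    vecSwap_of_ne i ζ a1.symm a3.symm, vecSwap_of_ne i ζ a2.symm a4.symm, map_add, map_smul,
    heckeT_comm hs hs1 i j hij]
  module

theorem ybStep_braid {i j : Fin n} (hij : (i : ℕ) + 1 = j) {ζ : Fin (n + 1) → K}
    (h0 : ∀ a, ζ a ≠ 0) (h12 : ζ i.castSucc ≠ ζ i.succ) (h13 : ζ i.castSucc ≠ ζ j.succ)
    (h23 : ζ j.castSucc ≠ ζ j.succ) (P : VecPoly K n μ) :
    ybStep s (vecSwap j (vecSwap i ζ)) i (ybStep s (vecSwap i ζ) j (ybStep s ζ i P))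
      = ybStep s (vecSwap i (vecSwap j ζ)) j (ybStep s (vecSwap j ζ) i (ybStep s ζ j P)) := by
  have e : j.castSucc = i.succ := by simp [Fin.ext_iff]; omega
  have a1 : i.castSucc ≠ i.succ := (Fin.castSucc_lt_succ (i := i)).ne
  have a2 : j.succ ≠ i.castSucc := by simp [Fin.ext_iff]; omega
  have a4 : j.succ ≠ i.succ := by simp [Fin.ext_iff]; omega
  have B0 : ∀ u : Fin (n + 1) → K, vecSwap j u i.castSucc = u i.castSucc := fun u =>
    vecSwap_of_ne j u (by rw [e]; exact a1) a2.symm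
  have B1 : ∀ u : Fin (n + 1) → K, vecSwap j u i.succ = u j.succ := fun u => by
    rw [← e, vecSwap_castSucc]
  have A2 : ∀ u : Fin (n + 1) → K, vecSwap i u j.succ = u j.succ := fun u =>
    vecSwap_of_ne i u a2 a4
  have h := yangBaxter_sub s (heckeT s i) (heckeT s j) (heckeT_quadratic hs hs1 i)
    (heckeT_quadratic hs hs1 j)
    (stepCoeff_triple (s := s) (h0 i.castSucc) (h0 i.succ) h12 h13 (e ▸ h23)) P
  rw [heckeT_braid hs hs1 i j hij, sub_self, sub_eq_zero] at h
  simp only [ybStep, e, B0, B1, A2, vecSwap_castSucc, vecSwap_succ]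
  exact h

theorem ybStep_vecSwap_ybStep {ζ : Fin (n + 1) → K} {i : Fin n} (h0 : ∀ a, ζ a ≠ 0)
    (h : ζ i.castSucc ≠ ζ i.succ) (P : VecPoly K n μ) :
    ybStep s (vecSwap i ζ) i (ybStep s ζ i P)
      = ((ζ i.castSucc - s * ζ i.succ) * (s * ζ i.castSucc - ζ i.succ)
          / (ζ i.castSucc - ζ i.succ) ^ 2) • P := by
  rw [← stepCoeff_mul_swap (h0 _) (h0 _) h]
  simp only [ybStep, vecSwap_castSucc, vecSwap_succ]
  exact step_step_swap s (heckeT s i) (heckeT_quadratic hs hs1 i)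
    (stepCoeff_add_swap (h0 _) (h0 _) h) P

theorem raising_ybStep (g : K → K) {i k : Fin n} (hik : (i : ℕ) + 1 = k) (ζ : Fin (n + 1) → K)
    (P : VecPoly K n μ) :
    raising s (ybStep s ζ k P) = ybStep s (vecRotate g ζ) i (raising s P) := by
  have e : i.succ = k.castSucc := by simp [Fin.ext_iff]; omega
  rw [ybStep, ybStep, raising_add, raising_smul, raising_heckeT hs hs1 hik, e,
    vecRotate_castSucc, vecRotate_castSucc, e]

theorem raising_raising_ybStep {q : K} (hq : q ≠ 0) {j k : Fin n} (hj : (j : ℕ) = 0)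
    (hk : (k : ℕ) + 1 = n) (ζ : Fin (n + 1) → K) (P : VecPoly K n μ) :
    raising s (raising s (ybStep s ζ j P))
      = ybStep s (vecRotate (fun z => q * z) (vecRotate (fun z => q * z) ζ)) k
        (raising s (raising s P)) := by
  have e0 : (0 : Fin (n + 1)) = j.castSucc := by simp [Fin.ext_iff]; omega
  have el : k.succ = Fin.last n := by simp [Fin.ext_iff]; omega
  rw [ybStep, ybStep, raising_add, raising_smul, raising_add, raising_smul,
    raising_raising_heckeT hs hs1 hj hk, vecRotate_castSucc, el, vecRotate_last, vecRotate_last,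
    e0, vecRotate_castSucc]
  congr 2
  rw [stepCoeff, stepCoeff, mul_div_mul_left _ _ hq]

end Steps

/-! ### The canonical polynomials -/

/-- Only zeros follow the nonzero entry `i + 1` of `w`, and the entry `i` vanishes: from `w`, the
arrow `s_i` moves the last nonzero entry to the left. -/
def IsLeading (w : Fin (n + 1) → ℕ) (i : Fin n) : Prop :=
  w i.castSucc = 0 ∧ w i.succ ≠ 0 ∧ ∀ a, i.succ < a → w a = 0

/-- The inverse of the rotation of exponents, `[v_1, …, v_N] ↦ [v_N - 1, v_1, …, v_{N-1}]`. -/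
def unrotate (v : Fin (n + 1) → ℕ) : Fin (n + 1) → ℕ :=
  Fin.cons (α := fun _ => ℕ) (v (Fin.last n) - 1) (fun j : Fin n => v j.castSucc)

theorem vecRotate_unrotate {v : Fin (n + 1) → ℕ} (h : v (Fin.last n) ≠ 0) :
    vecRotate (fun k => k + 1) (unrotate v) = v := by
  funext a
  induction a using Fin.lastCases with
  | last =>
    rw [vecRotate_last, unrotate, Fin.cons_zero]
    exact Nat.succ_pred_eq_of_ne_zero h
  | cast a => rw [vecRotate_castSucc, unrotate, Fin.cons_succ]

theorem unrotate_vecRotate (v : Fin (n + 1) → ℕ) :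
    unrotate (vecRotate (fun k => k + 1) v) = v := by
  funext a
  induction a using Fin.cases with
  | zero => rw [unrotate, Fin.cons_zero, vecRotate_last, Nat.add_sub_cancel]
  | succ a => rw [unrotate, Fin.cons_succ, vecRotate_castSucc]

/-- A second order term for the recursion on exponents; it grows when the last nonzero entry
moves to the left. -/
def leftness (v : Fin (n + 1) → ℕ) : ℕ := ∑ a : Fin (n + 1), if v a = 0 then 0 else n - a

/-- The quantity on which the recursion on exponents is based: the degree has priority, then
`leftness` counts. -/
def weight (v : Fin (n + 1) → ℕ) : ℕ :=
  (∑ a, v a) * ((n + 1) * (n + 1)) + leftness v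

theorem leftness_lt (v : Fin (n + 1) → ℕ) : leftness v < (n + 1) * (n + 1) := by
  have : leftness v ≤ ∑ _a : Fin (n + 1), n :=
    Finset.sum_le_sum fun a _ => by split_ifs <;> omega
  simp only [Finset.sum_const, Finset.card_univ, Fintype.card_fin, smul_eq_mul] at this
  nlinarith

theorem weight_lt_weight_vecRotate (v : Fin (n + 1) → ℕ) :
    weight v < weight (vecRotate (fun k => k + 1) v) := by
  have h : ∑ a, vecRotate (fun k => k + 1) v a = ∑ a, v a + 1 := by
    rw [Fin.sum_univ_castSucc, Fin.sum_univ_succ]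
    simp only [vecRotate_castSucc, vecRotate_last]
    ring
  have := leftness_lt v
  rw [weight, weight, h, Nat.succ_mul (∑ a, v a)]
  omega

theorem sum_vecSwap (i : Fin n) (v : Fin (n + 1) → ℕ) : ∑ a, vecSwap i v a = ∑ a, v a :=
  Equiv.sum_comp (Equiv.swap i.castSucc i.succ) v

theorem weight_lt_weight_vecSwap {w : Fin (n + 1) → ℕ} {i : Fin n} (h0 : w i.castSucc = 0)
    (h1 : w i.succ ≠ 0) : weight w < weight (vecSwap i w) := by
  have hn := i.2
  rw [weight, weight, sum_vecSwap]
  refine Nat.add_lt_add_left ?_ _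
  have e : leftness w = ∑ a, if vecSwap i w a = 0 then 0
      else n - (Equiv.swap i.castSucc i.succ a : Fin (n + 1)) :=
    (Equiv.sum_comp (Equiv.swap i.castSucc i.succ)
      (fun a : Fin (n + 1) => if w a = 0 then 0 else n - (a : ℕ))).symm
  rw [e, leftness]
  refine Finset.sum_lt_sum (fun a _ => ?_) ⟨i.castSucc, Finset.mem_univ _, ?_⟩
  · rcases eq_or_ne a i.castSucc with rfl | ha
    · rw [Equiv.swap_apply_left, Fin.val_succ, Fin.val_castSucc]
      split_ifs <;> omega
    rcases eq_or_ne a i.succ with rfl | hb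
    · rw [vecSwap_succ, h0, if_pos rfl, if_pos rfl]
    · rw [Equiv.swap_apply_of_ne_of_ne ha hb]
  · rw [vecSwap_castSucc, if_neg h1, if_neg h1, Equiv.swap_apply_left, Fin.val_succ,
      Fin.val_castSucc]
    omega

open Classical in
/-- The polynomial of a distinguished path to the vertex with exponent `v` and tableau `T`: the
last arrow is affine if the last entry of `v` is positive, and moves the last nonzero entry of `v`
to the left otherwise; for `v = 0` the polynomial is `1 ⊗ T`. -/
def canonPoly (q s : K) (T : RST n μ) (v : Fin (n + 1) → ℕ) : VecPoly K n μ :=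
  if _h : v (Fin.last n) ≠ 0 then raising s (canonPoly q s T (unrotate v))
  else if h : ∃ i, IsLeading (vecSwap i v) i then
    ybStep s (spectralVector q s (vecSwap h.choose v) T) h.choose
      (canonPoly q s T (vecSwap h.choose v))
  else 1 ⊗ₜ[K] Finsupp.single T 1
termination_by weight v
decreasing_by
  · conv_rhs => rw [← vecRotate_unrotate _h]
    exact weight_lt_weight_vecRotate _
  · have := weight_lt_weight_vecSwap h.choose_spec.1 h.choose_spec.2.1
    rwa [vecSwap_vecSwap] at this

theorem canonPoly_vecRotate (q s : K) (T : RST n μ) (v : Fin (n + 1) → ℕ) :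
    canonPoly q s T (vecRotate (fun k => k + 1) v) = raising s (canonPoly q s T v) := by
  rw [canonPoly, dif_pos (by rw [vecRotate_last]; omega), unrotate_vecRotate]

theorem canonPoly_zero (q s : K) (T : RST n μ) :
    canonPoly q s T (fun _ => 0) = 1 ⊗ₜ[K] Finsupp.single T 1 := by
  rw [canonPoly, dif_neg (by simp), dif_neg]
  rintro ⟨i, -, h, -⟩
  exact h rfl

theorem IsLeading.vecSwap_last {w : Fin (n + 1) → ℕ} {i : Fin n} (h : IsLeading w i) :
    vecSwap i w (Fin.last n) = 0 := by
  rcases eq_or_ne (Fin.last n) i.succ with h1 | h1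
  · rw [h1, vecSwap_succ, h.1]
  · rw [vecSwap_of_ne _ _ (Fin.castSucc_lt_last i).ne' h1]
    exact h.2.2 _ (lt_of_le_of_ne (Fin.le_last _) h1.symm)

theorem IsLeading.unique {v : Fin (n + 1) → ℕ} {i j : Fin n} (hi : IsLeading (vecSwap i v) i)
    (hj : IsLeading (vecSwap j v) j) : i = j := by
  have key : ∀ i j : Fin n, IsLeading (vecSwap i v) i → IsLeading (vecSwap j v) j →
      ¬ i < j := by
    intro i j hi hj hij
    have h1 := hj.2.1
    rw [vecSwap_succ] at h1
    apply h1
    rcases eq_or_ne j.castSucc i.succ with h2 | h2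
    · have := hi.1
      rwa [vecSwap_castSucc, ← h2] at this
    · have h3 : i.succ < j.castSucc := by
        simp only [Fin.lt_def, ne_eq, Fin.ext_iff, Fin.val_castSucc, Fin.val_succ] at hij h2 ⊢
        omega
      rw [← hi.2.2 _ h3, vecSwap_of_ne _ _ _ h2]
      simp only [Fin.lt_def, ne_eq, Fin.ext_iff, Fin.val_castSucc] at hij ⊢
      omega
  exact le_antisymm (not_lt.1 (key j i hj hi)) (not_lt.1 (key i j hi hj))

theorem canonPoly_vecSwap (q s : K) (T : RST n μ) {w : Fin (n + 1) → ℕ} {i : Fin n}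
    (h : IsLeading w i) :
    canonPoly q s T (vecSwap i w)
      = ybStep s (spectralVector q s w T) i (canonPoly q s T w) := by
  have hex : ∃ j, IsLeading (vecSwap j (vecSwap i w)) j := ⟨i, by rwa [vecSwap_vecSwap]⟩
  have hi : hex.choose = i := hex.choose_spec.unique (by rwa [vecSwap_vecSwap])
  rw [canonPoly, dif_neg (by rw [h.vecSwap_last]; simp), dif_pos hex, hi, vecSwap_vecSwap]

theorem weight_vecSwap_of_ne_zero {v : Fin (n + 1) → ℕ} {i : Fin n} (h0 : v i.castSucc ≠ 0)
    (h1 : v i.succ ≠ 0) : weight (vecSwap i v) = weight v := by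
  rw [weight, weight, sum_vecSwap, leftness, leftness]
  congr 1
  refine Finset.sum_congr rfl fun a _ => ?_
  rcases eq_or_ne a i.castSucc with rfl | ha
  · rw [vecSwap_castSucc, if_neg h0, if_neg h1]
  rcases eq_or_ne a i.succ with rfl | hb
  · rw [vecSwap_succ, if_neg h0, if_neg h1]
  · rw [vecSwap_of_ne _ _ ha hb]

/-- Every exponent is zero, or a rotation, or obtained from a smaller one by moving the last
nonzero entry to the left. -/
theorem exponent_cases (v : Fin (n + 1) → ℕ) :
    v = (fun _ => 0) ∨ (∃ u, v = vecRotate (fun k => k + 1) u) ∨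
      ∃ i w, IsLeading w i ∧ v = vecSwap i w := by
  by_cases hl : v (Fin.last n) = 0
  swap
  · exact Or.inr (Or.inl ⟨unrotate v, (vecRotate_unrotate hl).symm⟩)
  by_cases h0 : ∃ a, v a ≠ 0
  swap
  · left
    push Not at h0
    exact funext h0
  obtain ⟨a, ha⟩ := h0
  obtain ⟨b, hb, hmax⟩ := (Finset.univ.filter fun a => v a ≠ 0).exists_max_image id
    ⟨a, by simpa using ha⟩
  rw [Finset.mem_filter] at hb
  have hmax' : ∀ c, b < c → v c = 0 := fun c hc => by
    by_contra h
    exact (hmax c (by simpa using h)).not_gt hc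
  induction b using Fin.lastCases with
  | last => exact absurd hl hb.2
  | cast i =>
    refine Or.inr (Or.inr ⟨i, vecSwap i v, ⟨?_, ?_, fun c hc => ?_⟩, (vecSwap_vecSwap i v).symm⟩)
    · rw [vecSwap_castSucc]
      exact hmax' _ Fin.castSucc_lt_succ
    · rw [vecSwap_succ]
      exact hb.2
    · rw [vecSwap_of_ne _ _ (Fin.castSucc_lt_succ.trans hc).ne' hc.ne']
      exact hmax' _ (Fin.castSucc_lt_succ.trans hc)

/-! ### Steps between canonical polynomials -/

/-- The effect of every Yang-Baxter step on the canonical polynomials with exponent `v`, except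
for the steps at a descent of `v`: it exchanges two increasing entries of the exponent, and for
two equal entries it exchanges letters of the tableau, up to a scalar. -/
def StepsKnown (q s : K) (μ : YoungDiagram) (v : Fin (n + 1) → ℕ) : Prop :=
  ∀ (T : RST n μ) (i : Fin n),
    (v i.castSucc < v i.succ →
      ybStep s (spectralVector q s v T) i (canonPoly q s T v) = canonPoly q s T (vecSwap i v)) ∧
    (∀ k : Fin n, v i.castSucc = v i.succ → rankFun v i.castSucc = k.castSucc →
      ybStep s (spectralVector q s v T) i (canonPoly q s T v)
        = exchangeCoeff s (T.content k.succ - T.content k.castSucc)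
          • canonPoly q s (T.adjSwap k) v)

section

variable {q s : K} (hq : q ≠ 0) (hs : s ≠ 0)
  (hqs : ∀ a b : ℤ, q ^ a * s ^ b = 1 → a = 0 ∧ b = 0)

include hqs in
theorem zpow_eq_one_imp (b : ℤ) (hb : s ^ b = 1) : b = 0 :=
  (hqs 0 b (by rw [zpow_zero, one_mul, hb])).2

include hs hqs

theorem stepsKnown_zero : StepsKnown q s μ (fun _ : Fin (n + 1) => 0) := by
  refine fun T i => ⟨fun h => absurd h (lt_irrefl _), fun k _ hk => ?_⟩
  rw [rankFun_zero] at hk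
  obtain rfl : i = k := Fin.castSucc_injective _ hk
  rw [canonPoly_zero, canonPoly_zero, ybStep, heckeT_one_tmul, ← TensorProduct.tmul_smul,
    ← TensorProduct.tmul_add, ← TensorProduct.tmul_smul,
    ← tableauHecke_single hs (zpow_eq_one_imp hqs)]
  simp only [spectralVector, rankFun_zero, pow_zero, one_mul]
  rfl

/-- A step far from the last nonzero entry commutes with the last arrow. -/
theorem stepsKnown_of_isLeading_far {w : Fin (n + 1) → ℕ} {i j : Fin n} (hw : IsLeading w j)
    (hij : (i : ℕ) + 1 < j ∨ (j : ℕ) + 1 < i) (ih : StepsKnown q s μ w) (T : RST n μ) :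
    (vecSwap j w i.castSucc < vecSwap j w i.succ →
      ybStep s (spectralVector q s (vecSwap j w) T) i (canonPoly q s T (vecSwap j w))
        = canonPoly q s T (vecSwap i (vecSwap j w))) ∧
    (∀ k : Fin n, vecSwap j w i.castSucc = vecSwap j w i.succ →
      rankFun (vecSwap j w) i.castSucc = k.castSucc →
      ybStep s (spectralVector q s (vecSwap j w) T) i (canonPoly q s T (vecSwap j w))
        = exchangeCoeff s (T.content k.succ - T.content k.castSucc)
          • canonPoly q s (T.adjSwap k) (vecSwap j w)) := by
  have hs1 := zpow_eq_one_imp hqs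
  obtain ⟨a1, a2, a3, a4⟩ := castSucc_ne_succ_of_far hij
  have hne : w j.castSucc ≠ w j.succ := by rw [hw.1]; exact hw.2.1.symm
  obtain ⟨hA, hB⟩ := ih T i
  rw [spectralVector_vecSwap q s T hne, canonPoly_vecSwap q s T hw, ybStep_comm hs hs1 hij,
    rankFun_vecSwap hne, vecSwap_of_ne j w a1 a2, vecSwap_of_ne j w a3 a4,
    vecSwap_of_ne j _ a1 a2]
  refine ⟨fun h => ?_, fun k h hk => ?_⟩
  · have hw' : IsLeading (vecSwap i w) j := by
      refine ⟨?_, ?_, fun a ha => ?_⟩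
      · rw [vecSwap_of_ne i w a1.symm a3.symm, hw.1]
      · rw [vecSwap_of_ne i w a2.symm a4.symm]
        exact hw.2.1
      · rcases eq_or_ne a i.castSucc with rfl | h1
        · rw [vecSwap_castSucc]
          exact hw.2.2 _ (ha.trans Fin.castSucc_lt_succ)
        rcases eq_or_ne a i.succ with rfl | h2
        · have := hw.2.2 _ ha
          omega
        · rw [vecSwap_of_ne i w h1 h2]
          exact hw.2.2 _ ha
    rw [hA h, ← spectralVector_vecSwap q s T h.ne, ← canonPoly_vecSwap q s T hw',
      vecSwap_comm hij]
  · rw [hB k h hk, ybStep_smul]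
    rcases exchangeCoeff_eq_zero_or s T k with h0 | hT
    · rw [h0, zero_smul, zero_smul]
    · rw [← spectralVector_adjSwap q s h hk hT, ← canonPoly_vecSwap q s _ hw]

include hq

/-- If the last arrow is affine, the step at `i < N - 1` comes from the step at `i + 1` before that
arrow. The step at `N - 1` comes from the step at `1` before the last two arrows, or it is an arrow
of the distinguished path. -/
theorem stepsKnown_vecRotate {u : Fin (n + 1) → ℕ}
    (ih : ∀ w : Fin (n + 1) → ℕ, weight w < weight (vecRotate (fun k => k + 1) u) →
      StepsKnown q s μ w) :
    StepsKnown q s μ (vecRotate (fun k => k + 1) u) := by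
  have hs1 := zpow_eq_one_imp hqs
  intro T i
  by_cases hi : (i : ℕ) + 1 < n
  · obtain ⟨k', hk'⟩ : ∃ k' : Fin n, (i : ℕ) + 1 = k' := ⟨⟨i + 1, hi⟩, rfl⟩
    have e : i.succ = k'.castSucc := by simp [Fin.ext_iff]; omega
    have h1 : vecRotate (fun k => k + 1) u i.castSucc = u k'.castSucc := by
      rw [vecRotate_castSucc, e]
    have h2 : vecRotate (fun k => k + 1) u i.succ = u k'.succ := by
      rw [e, vecRotate_castSucc]
    have h3 : ybStep s (spectralVector q s (vecRotate (fun k => k + 1) u) T) i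
        (canonPoly q s T (vecRotate (fun k => k + 1) u))
        = raising s (ybStep s (spectralVector q s u T) k' (canonPoly q s T u)) := by
      rw [raising_ybStep hs hs1 _ hk', spectralVector_vecRotate, canonPoly_vecRotate]
    obtain ⟨hA, hB⟩ := ih u (weight_lt_weight_vecRotate u) T k'
    rw [h1, h2, h3]
    refine ⟨fun h => ?_, fun k h hk => ?_⟩
    · rw [hA h, ← canonPoly_vecRotate, vecRotate_vecSwap _ hk']
    · rw [rankFun_vecRotate, vecRotate_castSucc, e] at hk
      rw [hB k h hk, raising_smul, canonPoly_vecRotate]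
  · have hin : (i : ℕ) + 1 = n := by have := i.2; omega
    have el : i.succ = Fin.last n := by simp [Fin.ext_iff]; omega
    by_cases hu : u (Fin.last n) = 0
    · have h1 : vecRotate (fun k => k + 1) u i.castSucc = 0 := by
        rw [vecRotate_castSucc, el, hu]
      have h2 : vecRotate (fun k => k + 1) u i.succ ≠ 0 := by
        rw [el, vecRotate_last]; omega
      refine ⟨fun _ => ?_, fun k h _ => absurd (h.symm.trans h1) h2⟩
      exact (canonPoly_vecSwap q s T ⟨h1, h2, fun a ha =>
        absurd ha (el ▸ (Fin.le_last a).not_gt)⟩).symm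
    · -- both of the last two entries are positive: undo two rotations
      rw [← vecRotate_unrotate hu] at ih ⊢
      generalize unrotate u = u' at ih ⊢
      obtain ⟨j, hj⟩ : ∃ j : Fin n, (j : ℕ) = 0 := ⟨⟨0, by omega⟩, rfl⟩
      have e0 : (0 : Fin (n + 1)) = j.castSucc := by simp [Fin.ext_iff]; omega
      have h1 : ∀ g : ℕ → ℕ, vecRotate g (vecRotate g u') i.castSucc = g (u' j.castSucc) :=
        fun g => by rw [vecRotate_castSucc, el, vecRotate_last, e0]
      have h2 : ∀ g : ℕ → ℕ, vecRotate g (vecRotate g u') i.succ = g (u' j.succ) :=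
        fun g => by rw [el, vecRotate_last, e0, vecRotate_castSucc]
      have h3 : ybStep s (spectralVector q s (vecRotate (fun k => k + 1)
          (vecRotate (fun k => k + 1) u')) T) i
          (canonPoly q s T (vecRotate (fun k => k + 1) (vecRotate (fun k => k + 1) u')))
          = raising s (raising s (ybStep s (spectralVector q s u' T) j (canonPoly q s T u'))) := by
        rw [raising_raising_ybStep hs hs1 hq hj hin, spectralVector_vecRotate,
          spectralVector_vecRotate, canonPoly_vecRotate, canonPoly_vecRotate]
      obtain ⟨hA, hB⟩ := ih u' ((weight_lt_weight_vecRotate u').trans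
        (weight_lt_weight_vecRotate _)) T j
      rw [h1, h2, h3]
      refine ⟨fun h => ?_, fun k h hk => ?_⟩
      · rw [hA (by omega), ← canonPoly_vecRotate, ← canonPoly_vecRotate,
          vecRotate_vecRotate_vecSwap _ hj hin]
      · rw [rankFun_vecRotate, rankFun_vecRotate, vecRotate_castSucc, el, vecRotate_last, e0] at hk
        rw [hB k (by omega) hk, raising_smul, raising_smul, canonPoly_vecRotate,
          canonPoly_vecRotate]

/-- The step behind the last nonzero entry, where two zeros of the exponent have been passed. -/
theorem ybStep_of_isLeading_after {w : Fin (n + 1) → ℕ} {i j : Fin n} (hw : IsLeading w j)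
    (hji : (j : ℕ) + 1 = i)
    (ih : ∀ u : Fin (n + 1) → ℕ, weight u < weight (vecSwap j w) → StepsKnown q s μ u)
    (T : RST n μ) (k : Fin n) (hk : rankFun (vecSwap j w) i.castSucc = k.castSucc) :
    ybStep s (spectralVector q s (vecSwap j w) T) i (canonPoly q s T (vecSwap j w))
      = exchangeCoeff s (T.content k.succ - T.content k.castSucc)
        • canonPoly q s (T.adjSwap k) (vecSwap j w) := by
  have hs1 := zpow_eq_one_imp hqs
  have e : i.castSucc = j.succ := by simp [Fin.ext_iff]; omega
  have b1 : j.castSucc ≠ i.castSucc := by simp [Fin.ext_iff]; omega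
  have b2 : j.castSucc ≠ i.succ := by simp [Fin.ext_iff]; omega
  have hlt : j.succ < i.succ := by simp only [Fin.lt_def, Fin.val_succ]; omega
  -- around the positions `i - 1`, `i`, `i + 1`: `w = (0, a, 0)` comes from `w' = (0, 0, a)`
  obtain ⟨w', rfl⟩ : ∃ w', w = vecSwap i w' := ⟨vecSwap i w, (vecSwap_vecSwap i w).symm⟩
  have hw0 : w' j.castSucc = 0 := by rw [← vecSwap_of_ne i w' b1 b2]; exact hw.1
  have hw1 : w' i.castSucc = 0 := by rw [← vecSwap_succ i w']; exact hw.2.2 _ hlt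
  have hw2 : w' i.succ ≠ 0 := by
    rw [← vecSwap_castSucc i w', e]; exact hw.2.1
  have hw' : IsLeading w' i := by
    refine ⟨hw1, hw2, fun a ha => ?_⟩
    rw [← vecSwap_of_ne i w' (Fin.castSucc_lt_succ.trans ha).ne' ha.ne']
    exact hw.2.2 a (hlt.trans ha)
  have hne : vecSwap i w' j.castSucc ≠ vecSwap i w' j.succ := by rw [hw.1]; exact hw.2.1.symm
  have hne' : w' i.castSucc ≠ w' i.succ := by rw [hw1]; exact hw2.symm
  have heq : w' j.castSucc = w' j.succ := by rw [hw0, ← e, hw1]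
  rw [rankFun_vecSwap hne, rankFun_vecSwap hne', e, vecSwap_succ, vecSwap_of_ne i _ b1 b2] at hk
  have hB := (ih w' ((weight_lt_weight_vecSwap hw1 hw2).trans
    (weight_lt_weight_vecSwap hw.1 hw.2.1)) T j).2 k heq hk
  rw [canonPoly_vecSwap q s T hw, canonPoly_vecSwap q s T hw', spectralVector_vecSwap q s T hne,
    spectralVector_vecSwap q s T hne',
    ← ybStep_braid hs hs1 hji (spectralVector_ne_zero hq hs w' T)
      (spectralVector_castSucc_ne_succ hq hs hqs w' T j)
      (spectralVector_ne_of_ne hq hs hqs (by rw [hw0]; exact hw2.symm))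
      (spectralVector_castSucc_ne_succ hq hs hqs w' T i), hB, ybStep_smul, ybStep_smul]
  rcases exchangeCoeff_eq_zero_or s T k with h0 | hT
  · rw [h0, zero_smul, zero_smul]
  · rw [← spectralVector_adjSwap q s heq hk hT, ← spectralVector_vecSwap q s _ hne',
      ← canonPoly_vecSwap q s _ hw', ← canonPoly_vecSwap q s _ hw]

/-- The step at the last nonzero entry and its left neighbour. -/
theorem stepsKnown_of_isLeading_before {w : Fin (n + 1) → ℕ} {i j : Fin n} (hw : IsLeading w j)
    (hij : (i : ℕ) + 1 = j)
    (ih : ∀ u : Fin (n + 1) → ℕ, weight u < weight (vecSwap j w) → StepsKnown q s μ u)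
    (T : RST n μ) :
    (vecSwap j w i.castSucc < vecSwap j w i.succ →
      ybStep s (spectralVector q s (vecSwap j w) T) i (canonPoly q s T (vecSwap j w))
        = canonPoly q s T (vecSwap i (vecSwap j w))) ∧
    (∀ k : Fin n, vecSwap j w i.castSucc = vecSwap j w i.succ →
      rankFun (vecSwap j w) i.castSucc = k.castSucc →
      ybStep s (spectralVector q s (vecSwap j w) T) i (canonPoly q s T (vecSwap j w))
        = exchangeCoeff s (T.content k.succ - T.content k.castSucc)
          • canonPoly q s (T.adjSwap k) (vecSwap j w)) := by
  have hs1 := zpow_eq_one_imp hqs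
  have e : j.castSucc = i.succ := by simp [Fin.ext_iff]; omega
  have b1 : i.castSucc ≠ j.castSucc := by simp [Fin.ext_iff]; omega
  have b2 : i.castSucc ≠ j.succ := by simp [Fin.ext_iff]; omega
  have b3 : j.succ ≠ i.succ := by simp [Fin.ext_iff]; omega
  have hlt : i.succ < j.succ := by simp only [Fin.lt_def, Fin.val_succ]; omega
  have hzero : ∀ a, i.succ < a → vecSwap j w a = 0 := fun a ha => by
    rcases eq_or_ne a j.succ with rfl | h1
    · rw [vecSwap_succ, hw.1]
    · rw [vecSwap_of_ne j w (e ▸ ha.ne') h1]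
      refine hw.2.2 a ?_
      simp only [Fin.lt_def, Fin.val_succ, ne_eq, Fin.ext_iff] at ha h1 ⊢
      omega
  have v1 : vecSwap j w i.succ = w j.succ := by rw [← e, vecSwap_castSucc]
  have v0 : vecSwap j w i.castSucc = w i.castSucc := vecSwap_of_ne j w b1 b2
  by_cases hc : w i.castSucc = 0
  · refine ⟨fun _ => (canonPoly_vecSwap q s T ⟨v0.trans hc, v1 ▸ hw.2.1, hzero⟩).symm,
      fun k h => ?_⟩
    rw [v0, v1, hc] at h
    exact absurd h.symm hw.2.1
  -- around the positions `i`, `i + 1`, `i + 2`: `w = (c, 0, a)` comes from `u = (0, c, a)`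
  obtain ⟨u, rfl⟩ : ∃ u, w = vecSwap i u := ⟨vecSwap i w, (vecSwap_vecSwap i w).symm⟩
  have hu0 : u i.castSucc = 0 := by rw [← vecSwap_succ i u, ← e]; exact hw.1
  have hu1 : u i.succ ≠ 0 := by rwa [← vecSwap_castSucc i u]
  have hu2 : u j.succ ≠ 0 := by rw [← vecSwap_of_ne i u b2.symm b3]; exact hw.2.1
  have hne : vecSwap i u j.castSucc ≠ vecSwap i u j.succ := by rw [hw.1]; exact hw.2.1.symm
  have hne' : u i.castSucc ≠ u i.succ := by rw [hu0]; exact hu1.symm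
  have hwt : weight u < weight (vecSwap j (vecSwap i u)) :=
    (weight_lt_weight_vecSwap hu0 hu1).trans (weight_lt_weight_vecSwap hw.1 hw.2.1)
  have hA := fun T => (ih u hwt T i).1 (by omega)
  have hbraid : ybStep s (spectralVector q s (vecSwap j (vecSwap i u)) T) i
      (canonPoly q s T (vecSwap j (vecSwap i u)))
      = ybStep s (vecSwap i (vecSwap j (spectralVector q s u T))) j
        (ybStep s (vecSwap j (spectralVector q s u T)) i
          (ybStep s (spectralVector q s u T) j (canonPoly q s T u))) := by
    rw [canonPoly_vecSwap q s T hw, ← hA, spectralVector_vecSwap q s T hne,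
      spectralVector_vecSwap q s T hne',
      ybStep_braid hs hs1 hij (spectralVector_ne_zero hq hs u T)
      (spectralVector_castSucc_ne_succ hq hs hqs u T i)
      (spectralVector_ne_of_ne hq hs hqs (by rw [hu0]; exact hu2.symm))
      (spectralVector_castSucc_ne_succ hq hs hqs u T j)]
  have v0' : vecSwap j (vecSwap i u) i.castSucc = u j.castSucc := by rw [v0, vecSwap_castSucc, e]
  have v1' : vecSwap j (vecSwap i u) i.succ = u j.succ := by rw [v1, vecSwap_of_ne i u b2.symm b3]
  rw [v0', v1', hbraid]
  refine ⟨fun h => ?_, fun k h hk => ?_⟩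
  · have h1 : vecSwap j u i.castSucc = 0 := by rw [vecSwap_of_ne j u b1 b2, hu0]
    have h2 : vecSwap j u i.succ ≠ 0 := by rwa [← e, vecSwap_castSucc]
    have hwt' : weight (vecSwap j u) < weight (vecSwap j (vecSwap i u)) := by
      rwa [weight_vecSwap_of_ne_zero (e ▸ hu1) hu2]
    have hlead : IsLeading (vecSwap i (vecSwap j u)) j := by
      refine ⟨?_, ?_, fun a ha => ?_⟩
      · rw [e, vecSwap_succ, h1]
      · rw [vecSwap_of_ne i _ b2.symm b3, vecSwap_succ, e]
        exact hu1
      · have c1 : a ≠ i.succ := (hlt.trans ha).ne'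
        have c2 : a ≠ i.castSucc := (Fin.castSucc_lt_succ.trans (hlt.trans ha)).ne'
        rw [vecSwap_of_ne i _ c2 c1, vecSwap_of_ne j u (e ▸ c1) ha.ne',
          ← vecSwap_of_ne i u c2 c1]
        exact hw.2.2 a ha
    rw [(ih u hwt T j).1 h, ← spectralVector_vecSwap q s T h.ne,
      (ih _ hwt' T i).1 (by omega), ← spectralVector_vecSwap q s T (by omega),
      ← canonPoly_vecSwap q s T hlead, vecSwap_braid hij]
  · rw [rankFun_vecSwap hne, rankFun_vecSwap hne', vecSwap_of_ne j _ b1 b2, vecSwap_castSucc,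
      ← e] at hk
    rw [(ih u hwt T j).2 k h hk, ybStep_smul, ybStep_smul]
    rcases exchangeCoeff_eq_zero_or s T k with h0 | hT
    · rw [h0, zero_smul, zero_smul]
    · rw [← spectralVector_adjSwap q s h hk hT, hA, ← spectralVector_vecSwap q s _ hne',
        ← canonPoly_vecSwap q s _ hw]

theorem stepsKnown_vecSwap {w : Fin (n + 1) → ℕ} {j : Fin n} (hw : IsLeading w j)
    (ih : ∀ u : Fin (n + 1) → ℕ, weight u < weight (vecSwap j w) → StepsKnown q s μ u) :
    StepsKnown q s μ (vecSwap j w) := by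
  intro T i
  rcases lt_trichotomy ((i : ℕ) + 1) j with h | h | h
  · exact stepsKnown_of_isLeading_far hs hqs hw (Or.inl h)
      (ih w (weight_lt_weight_vecSwap hw.1 hw.2.1)) T
  · exact stepsKnown_of_isLeading_before hq hs hqs hw h ih T
  rcases (Nat.lt_succ_iff.1 h).eq_or_lt with h | h
  · obtain rfl : j = i := Fin.ext h
    have h2 := hw.2.1
    rw [vecSwap_castSucc, vecSwap_succ, hw.1]
    exact ⟨fun h => absurd h (Nat.not_lt_zero _), fun k h => absurd h h2⟩
  rcases (Nat.succ_le_iff.2 h).eq_or_lt with h | h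
  · have e : i.castSucc = j.succ := by simp [Fin.ext_iff]; omega
    have h1 : vecSwap j w i.castSucc = 0 := by rw [e, vecSwap_succ, hw.1]
    exact ⟨fun h' => by
        have h2 : vecSwap j w i.succ = 0 := by
          rw [vecSwap_of_ne, hw.2.2]
          · simp only [Fin.lt_def, Fin.val_succ]; omega
          · simp only [ne_eq, Fin.ext_iff, Fin.val_succ, Fin.val_castSucc]; omega
          · simp only [ne_eq, Fin.ext_iff, Fin.val_succ]; omega
        omega,
      fun k _ hk => ybStep_of_isLeading_after hq hs hqs hw h ih T k hk⟩
  · exact stepsKnown_of_isLeading_far hs hqs hw (Or.inr h)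
      (ih w (weight_lt_weight_vecSwap hw.1 hw.2.1)) T

theorem stepsKnown (v : Fin (n + 1) → ℕ) : StepsKnown q s μ v := by
  induction hm : weight v using Nat.strong_induction_on generalizing v with
  | _ m ih =>
    subst hm
    have ih' : ∀ u, weight u < weight v → StepsKnown q s μ u := fun u hu => ih _ hu u rfl
    rcases exponent_cases v with rfl | ⟨u, rfl⟩ | ⟨i, w, hw, rfl⟩
    · exact stepsKnown_zero hs hqs
    · exact stepsKnown_vecRotate hq hs hqs ih'
    · exact stepsKnown_vecSwap hq hs hqs hw ih'

end

/-! ### Paths from the root -/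

/-- The vertex of the graph with exponent `v` and tableau `T`. -/
def canonVertex (q s : K) (v : Fin (n + 1) → ℕ) (T : RST n μ) : Vertex K n μ :=
  ⟨T, spectralVector q s v T, v, rankFun v⟩

theorem root_eq_canonVertex (q s : K) (h : μ.card = n + 1) :
    Vertex.root s h = canonVertex q s (fun _ => 0) (rootRST h) := by
  have h1 : spectralVector q s (fun _ => 0) (rootRST h)
      = fun j => s ^ (rootRST h).1.content j := by
    funext j
    rw [spectralVector, rankFun_zero, pow_zero, one_mul]
  have h2 : rankFun (fun _ : Fin (n + 1) => 0) = id := funext rankFun_zero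
  rw [Vertex.root, canonVertex, h1, h2]

theorem canonVertex_affine (q s : K) (v : Fin (n + 1) → ℕ) (T : RST n μ) :
    (canonVertex q s v T).affine q = canonVertex q s (vecRotate (fun k => k + 1) v) T := by
  rw [canonVertex, canonVertex, spectralVector_vecRotate, rankFun_vecRotate]
  rfl

theorem canonVertex_swap_of_lt (q s : K) {v : Fin (n + 1) → ℕ} (T : RST n μ) {i : Fin n}
    (h : v i.castSucc < v i.succ) :
    (canonVertex q s v T).swap i = canonVertex q s (vecSwap i v) T := by
  rw [Vertex.swap, if_pos (by exact h.ne'), canonVertex, canonVertex,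
    spectralVector_vecSwap q s T h.ne, rankFun_vecSwap h.ne]

theorem canonVertex_swap_of_eq (q s : K) {v : Fin (n + 1) → ℕ} {T : RST n μ} {i k : Fin n}
    (h : v i.castSucc = v i.succ) (hk : rankFun v i.castSucc = k.castSucc)
    (hk' : rankFun v i.succ = k.succ) (hT : (T.1.exchange k.castSucc k.succ).IsRST) :
    (canonVertex q s v T).swap i = canonVertex q s v (T.adjSwap k) := by
  have e1 : (canonVertex q s v T).perm i.castSucc = k.castSucc := hk
  have e2 : (canonVertex q s v T).perm i.succ = k.succ := hk'
  have e3 : (canonVertex q s v T).tab = T := rfl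
  rw [Vertex.swap, if_neg (by exact not_not.2 h.symm), e1, e2, e3, if_pos hT, canonVertex,
    canonVertex, spectralVector_adjSwap q s h hk hT]
  rfl

theorem exchangeCoeff_of_le {s : K} {m : ℤ} (h : m ≤ -2) : exchangeCoeff s m = 1 := by
  rw [exchangeCoeff, if_neg (by omega), if_pos (by omega)]

theorem canonVertex_hasArrow {q s : K} {v : Fin (n + 1) → ℕ} {T : RST n μ} {i k : Fin n}
    (h : v i.castSucc = v i.succ) (hk : rankFun v i.castSucc = k.castSucc)
    (hk' : rankFun v i.succ = k.succ) (hT : T.content k.succ + 2 ≤ T.content k.castSucc) :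
    (canonVertex q s v T).HasArrow i := by
  refine Or.inr ⟨h, rankFun_lt ?_, ?_, ?_⟩
  · exact Or.inl ⟨Fin.castSucc_lt_succ, h.ge⟩
  · change (T.1.exchange (rankFun v i.castSucc) (rankFun v i.succ)).IsRST
    rw [hk, hk', RST.exchange_isRST_iff]
    omega
  · change T.content (rankFun v i.succ) + 2 ≤ T.content (rankFun v i.castSucc)
    rwa [hk, hk']

/-- A tableau other than the root tableau has neighbouring letters `i`, `i + 1` of which the
second lies strictly to the north-east of the first. -/
theorem exists_northEast_of_ne_rootRST (h : μ.card = n + 1) {T : RST n μ} (hT : T ≠ rootRST h) :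
    ∃ i : Fin n, T.1.row i.succ < T.1.row i.castSucc ∧ T.1.col i.castSucc < T.1.col i.succ := by
  by_contra hno
  push Not at hno
  apply hT
  have key : ∀ f : Filling n μ, StrictAnti (fun a => columnOrder (f a).1) →
      StrictMono (fun a => columnOrder (f (Fin.rev a)).1) := fun f hf a b hab =>
    hf (Fin.rev_lt_rev.2 hab)
  have h1 : StrictAnti (fun a => columnOrder (T.1 a).1) := by
    rw [Fin.strictAnti_iff_succ_lt]
    intro i
    refine Prod.Lex.toLex_lt_toLex.2 ?_
    change T.1.col i.succ < T.1.col i.castSucc ∨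
      (T.1.col i.succ = T.1.col i.castSucc ∧ T.1.row i.succ < T.1.row i.castSucc)
    have := T.2.adjacent_cases i
    have := hno i
    omega
  have h2 : StrictAnti (fun a => columnOrder ((rootRST h).1 a).1) := by
    intro a b hab
    refine lt_of_not_ge fun hle => ?_
    rcases hle.lt_or_eq with hlt | heq
    · exact (rootFilling_lt h _ _ hlt).not_gt hab
    · exact hab.ne ((rootRST h).1.injective (Subtype.ext (columnOrder.injective heq)))
  have hrange : ∀ f : Filling n μ, Set.range (fun a => columnOrder (f (Fin.rev a)).1)
      = columnOrder '' (μ.cells : Set (ℕ × ℕ)) := by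
    intro f
    ext c
    constructor
    · rintro ⟨a, rfl⟩
      exact ⟨_, (f (Fin.rev a)).2, rfl⟩
    · rintro ⟨d, hd, rfl⟩
      exact ⟨Fin.rev (f.symm ⟨d, hd⟩), by simp⟩
  have h3 := (StrictMono.range_inj (key _ h1) (key _ h2)).1 ((hrange _).trans (hrange _).symm)
  refine Subtype.ext (Equiv.ext fun a => Subtype.ext (columnOrder.injective ?_))
  simpa using congrFun h3 (Fin.rev a)

section

variable {q s : K} (hq : q ≠ 0) (hs : s ≠ 0)
  (hqs : ∀ a b : ℤ, q ^ a * s ^ b = 1 → a = 0 ∧ b = 0)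
include hq hs hqs

theorem PathPolynomial.eq_canonPoly {h : μ.card = n + 1} {x : Vertex K n μ} {P : VecPoly K n μ}
    (hP : PathPolynomial q s h x P) :
    ∃ v T, x = canonVertex q s v T ∧ P = canonPoly q s T v := by
  induction hP with
  | root => exact ⟨_, _, root_eq_canonVertex q s h, (canonPoly_zero q s _).symm⟩
  | affine x P _ ih =>
    obtain ⟨v, T, rfl, rfl⟩ := ih
    exact ⟨_, T, canonVertex_affine q s v T, (canonPoly_vecRotate q s T v).symm⟩
  | swap x P i _ hi ih =>
    obtain ⟨v, T, rfl, rfl⟩ := ih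
    have hstep := stepsKnown hq hs hqs v T i
    rcases hi with hi | ⟨h1, -, h3, h4⟩
    · exact ⟨_, T, canonVertex_swap_of_lt q s T hi, hstep.1 hi⟩
    · obtain ⟨k, hk, hk'⟩ := exists_rankFun_eq (v := v) (i := i) h1
      change (T.1.exchange (rankFun v i.castSucc) (rankFun v i.succ)).IsRST at h3
      change T.content (rankFun v i.succ) + 2 ≤ T.content (rankFun v i.castSucc) at h4
      rw [hk, hk'] at h3 h4
      refine ⟨v, T.adjSwap k, canonVertex_swap_of_eq q s h1 hk hk' h3, ?_⟩
      have := hstep.2 k h1 hk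
      rw [exchangeCoeff_of_le (by omega), one_smul] at this
      exact this

theorem pathPolynomial_zero (h : μ.card = n + 1) (T : RST n μ) :
    PathPolynomial q s h (canonVertex q s (fun _ => 0) T) (canonPoly q s T (fun _ => 0)) := by
  -- unless `T` is the root tableau, it is the target of an arrow from `T.adjSwap i`, where the
  -- larger one of the letters `i`, `i + 1` lies further to the west, so that the sum is smaller
  induction hm : ∑ a : Fin (n + 1), (a : ℕ) * T.1.col a using Nat.strong_induction_on
    generalizing T with
  | _ m ih =>
    by_cases hT : T = rootRST h
    · rw [hT, ← root_eq_canonVertex, canonPoly_zero]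
      exact PathPolynomial.root
    obtain ⟨i, hr, hc⟩ := exists_northEast_of_ne_rootRST h hT
    have hRST : (T.1.exchange i.castSucc i.succ).IsRST :=
      (T.2.exchange_iff i).2 ⟨hr.ne', hc.ne⟩
    have hUT : (T.adjSwap i).adjSwap i = T := RST.adjSwap_adjSwap hRST
    have hcont : (T.adjSwap i).content i.succ + 2 ≤ (T.adjSwap i).content i.castSucc := by
      rw [RST.content_adjSwap hRST, RST.content_adjSwap hRST, Equiv.swap_apply_left,
        Equiv.swap_apply_right]
      unfold RST.content Filling.content
      omega
    have hRST' : ((T.adjSwap i).1.exchange i.castSucc i.succ).IsRST := by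
      rw [RST.exchange_isRST_iff]
      omega
    have hlt : ∑ a : Fin (n + 1), (a : ℕ) * (T.adjSwap i).1.col a < m := by
      have hcol : ∀ a, (T.adjSwap i).1.col a = T.1.col (Equiv.swap i.castSucc i.succ a) :=
        fun a => by rw [RST.adjSwap_eq hRST]; rfl
      rw [← hm]
      have hne : i.castSucc ≠ i.succ := (Fin.castSucc_lt_succ (i := i)).ne
      rw [← Finset.add_sum_erase _ _ (Finset.mem_univ i.castSucc),
        ← Finset.add_sum_erase _ _ (Finset.mem_erase.2 ⟨hne.symm, Finset.mem_univ i.succ⟩),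
        ← Finset.add_sum_erase (a := i.castSucc) Finset.univ
          (fun a : Fin (n + 1) => (a : ℕ) * T.1.col a)
          (Finset.mem_univ i.castSucc),
        ← Finset.add_sum_erase (a := i.succ) _ (fun a : Fin (n + 1) => (a : ℕ) * T.1.col a)
          (Finset.mem_erase.2 ⟨hne.symm, Finset.mem_univ i.succ⟩), ← add_assoc, ← add_assoc]
      refine add_lt_add_of_lt_of_le ?_ (Finset.sum_le_sum fun a ha => ?_)
      · rw [hcol, hcol, Equiv.swap_apply_left, Equiv.swap_apply_right, Fin.val_castSucc,
          Fin.val_succ]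
        rw [add_mul, add_mul]
        omega
      · rw [Finset.mem_erase, Finset.mem_erase] at ha
        rw [hcol, Equiv.swap_apply_of_ne_of_ne ha.2.1 ha.1]
    have hP := (ih _ hlt (T.adjSwap i) rfl).swap _ _ i
      (canonVertex_hasArrow rfl (rankFun_zero _) (rankFun_zero _) hcont)
    rw [canonVertex_swap_of_eq q s rfl (rankFun_zero _) (rankFun_zero _) hRST', hUT] at hP
    have hstep := (stepsKnown hq hs hqs (fun _ => 0) (T.adjSwap i) i).2 i rfl (rankFun_zero _)
    rw [exchangeCoeff_of_le (by omega), one_smul, hUT] at hstep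
    rw [← hstep]
    exact hP

theorem pathPolynomial_canonPoly (h : μ.card = n + 1) (T : RST n μ) (v : Fin (n + 1) → ℕ) :
    PathPolynomial q s h (canonVertex q s v T) (canonPoly q s T v) := by
  induction hm : weight v using Nat.strong_induction_on generalizing v with
  | _ m ih =>
    subst hm
    rcases exponent_cases v with rfl | ⟨u, rfl⟩ | ⟨i, w, hw, rfl⟩
    · exact pathPolynomial_zero hq hs hqs h T
    · rw [← canonVertex_affine, canonPoly_vecRotate]
      exact (ih _ (weight_lt_weight_vecRotate u) u rfl).affine
    · have hlt : w i.castSucc < w i.succ := by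
        have := hw.2.1
        rw [hw.1]
        omega
      rw [← canonVertex_swap_of_lt q s T hlt, canonPoly_vecSwap q s T hw]
      exact (ih _ (weight_lt_weight_vecSwap hw.1 hw.2.1) w rfl).swap _ _ i (Or.inl hlt)

theorem isPolynomialOf_spectralVector_iff (h : μ.card = n + 1) (T : RST n μ)
    (v : Fin (n + 1) → ℕ) (P : VecPoly K n μ) :
    IsPolynomialOf q s h (spectralVector q s v T) P ↔ P = canonPoly q s T v := by
  constructor
  · rintro ⟨x, hx, hP⟩
    obtain ⟨w, U, rfl, rfl⟩ := hP.eq_canonPoly hq hs hqs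
    obtain ⟨rfl, rfl⟩ := spectralVector_injective hq hs hqs hx
    rfl
  · rintro rfl
    exact ⟨_, rfl, pathPolynomial_canonPoly hq hs hqs h T v⟩

theorem wellDefinedAt_spectralVector (h : μ.card = n + 1) (T : RST n μ)
    (v : Fin (n + 1) → ℕ) : WellDefinedAt q s h (spectralVector q s v T) :=
  ⟨canonPoly q s T v, (isPolynomialOf_spectralVector_iff hq hs hqs h T v _).2 rfl,
    fun _ hP => (isPolynomialOf_spectralVector_iff hq hs hqs h T v _).1 hP⟩

theorem macdonald_spectralVector (h : μ.card = n + 1) (T : RST n μ) (v : Fin (n + 1) → ℕ) :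
    macdonald q s h (spectralVector q s v T) = canonPoly q s T v := by
  have hex : ∃ P, IsPolynomialOf q s h (spectralVector q s v T) P :=
    ⟨_, (isPolynomialOf_spectralVector_iff hq hs hqs h T v _).2 rfl⟩
  rw [macdonald, dif_pos hex]
  exact (isPolynomialOf_spectralVector_iff hq hs hqs h T v _).1 hex.choose_spec

/-! ### Comparison of the entries of a spectral vector -/

theorem specGT_spectralVector_iff (v : Fin (n + 1) → ℕ) (T : RST n μ) (x y : Fin (n + 1)) :
    SpecGT q s (spectralVector q s v T x) (spectralVector q s v T y) ↔
      v y < v x ∨ (v x = v y ∧ T.content (rankFun v x) ≤ T.content (rankFun v y) - 2) := by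
  constructor
  · rintro ⟨a, b, c, d, h1, h2, h3⟩
    rw [spectralVector_eq] at h1 h2
    have := exponents_unique hq hs hqs h1
    have := exponents_unique hq hs hqs h2
    omega
  · intro h
    exact ⟨_, _, _, _, spectralVector_eq q s v T x, spectralVector_eq q s v T y, by omega⟩

theorem specNsim_spectralVector_iff (v : Fin (n + 1) → ℕ) (T : RST n μ) (x y : Fin (n + 1)) :
    SpecNsim q s (spectralVector q s v T x) (spectralVector q s v T y) ↔
      v x = v y ∧ |T.content (rankFun v x) - T.content (rankFun v y)| = 1 := by
  constructor
  · rintro ⟨a, b, c, d, h1, h2, h3, h4⟩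
    rw [spectralVector_eq] at h1 h2
    obtain ⟨e1, e2⟩ := exponents_unique hq hs hqs h1
    obtain ⟨e3, e4⟩ := exponents_unique hq hs hqs h2
    rw [e2, e4]
    exact ⟨by omega, h4⟩
  · intro h
    exact ⟨_, _, _, _, spectralVector_eq q s v T x, spectralVector_eq q s v T y, by omega, h.2⟩

/-- A step along an arrow exchanges two entries of the spectral vector. -/
theorem ybStep_canonPoly_of_specGT {v : Fin (n + 1) → ℕ} {T : RST n μ} {i : Fin n}
    (h : SpecGT q s (spectralVector q s v T i.succ) (spectralVector q s v T i.castSucc)) :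
    ∃ (w : Fin (n + 1) → ℕ) (U : RST n μ),
      spectralVector q s w U = vecSwap i (spectralVector q s v T) ∧
      ybStep s (spectralVector q s v T) i (canonPoly q s T v) = canonPoly q s U w := by
  have hstep := stepsKnown hq hs hqs v T i
  rcases (specGT_spectralVector_iff hq hs hqs v T _ _).1 h with hv | ⟨hv, hT⟩
  · exact ⟨vecSwap i v, T, spectralVector_vecSwap q s T hv.ne, hstep.1 hv⟩
  · obtain ⟨k, hk, hk'⟩ := exists_rankFun_eq hv.symm
    rw [hk, hk'] at hT
    refine ⟨v, T.adjSwap k, spectralVector_adjSwap q s hv.symm hk ?_, ?_⟩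
    · rw [RST.exchange_isRST_iff]
      omega
    · rw [hstep.2 k hv.symm hk, exchangeCoeff_of_le (by omega), one_smul]

/-- If the entries of a spectral vector are comparable in the direction opposite to an arrow, then
the vector with the two entries exchanged is the spectral vector of the source of that arrow. -/
theorem exists_spectralVector_eq_vecSwap {v : Fin (n + 1) → ℕ} {T : RST n μ} {i : Fin n}
    (h : SpecGT q s (spectralVector q s v T i.castSucc) (spectralVector q s v T i.succ)) :
    ∃ (w : Fin (n + 1) → ℕ) (U : RST n μ),
      spectralVector q s w U = vecSwap i (spectralVector q s v T) := by
  rcases (specGT_spectralVector_iff hq hs hqs v T _ _).1 h with hv | ⟨hv, hT⟩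
  · exact ⟨vecSwap i v, T, spectralVector_vecSwap q s T hv.ne'⟩
  · obtain ⟨k, hk, hk'⟩ := exists_rankFun_eq hv
    rw [hk, hk'] at hT
    refine ⟨v, T.adjSwap k, spectralVector_adjSwap q s hv hk ?_⟩
    rw [RST.exchange_isRST_iff]
    omega

end

end

end VVMac

theorem mainTheorem13 {K : Type*} [Field K] (q s : K) (hq : q ≠ 0) (hs : s ≠ 0)
    (hqs : ∀ a b : ℤ, q ^ a * s ^ b = 1 → a = 0 ∧ b = 0)
    (n : ℕ) (μ : YoungDiagram) (hμ : μ.card = n + 1)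
    (v : Fin (n + 1) → ℕ) (T : VVMac.RST n μ) (ζ : Fin (n + 1) → K)
    (hζ : ζ = VVMac.spectralVector q s v T) :
    VVMac.WellDefinedAt q s hμ ζ ∧
    (∀ i : Fin n,
      (VVMac.SpecGT q s (ζ i.succ) (ζ i.castSucc) ∨ VVMac.SpecGT q s (ζ i.castSucc) (ζ i.succ) ∨
        VVMac.SpecNsim q s (ζ i.castSucc) (ζ i.succ)) ∧
      (VVMac.SpecGT q s (ζ i.succ) (ζ i.castSucc) →
        VVMac.WellDefinedAt q s hμ (VVMac.vecSwap i ζ) ∧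
        VVMac.heckeT s i (VVMac.macdonald q s hμ ζ)
            + ((1 - s) * ζ i.castSucc / (ζ i.castSucc - ζ i.succ)) • VVMac.macdonald q s hμ ζ
          = VVMac.macdonald q s hμ (VVMac.vecSwap i ζ)) ∧
      (VVMac.SpecGT q s (ζ i.castSucc) (ζ i.succ) →
        VVMac.WellDefinedAt q s hμ (VVMac.vecSwap i ζ) ∧
        VVMac.heckeT s i (VVMac.macdonald q s hμ ζ)
            + ((1 - s) * ζ i.castSucc / (ζ i.castSucc - ζ i.succ)) • VVMac.macdonald q s hμ ζ
          = ((ζ i.castSucc - s * ζ i.succ) * (s * ζ i.castSucc - ζ i.succ)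
                / (ζ i.castSucc - ζ i.succ) ^ 2)
              • VVMac.macdonald q s hμ (VVMac.vecSwap i ζ)) ∧
      (VVMac.SpecNsim q s (ζ i.castSucc) (ζ i.succ) →
        VVMac.heckeT s i (VVMac.macdonald q s hμ ζ)
            + ((1 - s) * ζ i.castSucc / (ζ i.castSucc - ζ i.succ)) • VVMac.macdonald q s hμ ζ
          = 0)) ∧
    (VVMac.WellDefinedAt q s hμ (VVMac.vecRotate (fun z => q * z) ζ) ∧
      VVMac.raising s (VVMac.macdonald q s hμ ζ)
        = VVMac.macdonald q s hμ (VVMac.vecRotate (fun z => q * z) ζ)) := by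
  subst hζ
  have hs1 := VVMac.zpow_eq_one_imp hqs
  have hmac := fun U w => VVMac.macdonald_spectralVector hq hs hqs hμ U w
  have hwd := fun U w => VVMac.wellDefinedAt_spectralVector hq hs hqs hμ U w
  have h0 := VVMac.spectralVector_ne_zero hq hs v T
  refine ⟨hwd T v, fun i => ?_, ?_⟩
  · have hco : ∀ P : VVMac.VecPoly K n μ, VVMac.heckeT s i P
        + ((1 - s) * VVMac.spectralVector q s v T i.castSucc
          / (VVMac.spectralVector q s v T i.castSucc - VVMac.spectralVector q s v T i.succ)) • P
        = VVMac.ybStep s (VVMac.spectralVector q s v T) i P := fun P => by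
      rw [VVMac.ybStep, VVMac.stepCoeff_eq (h0 _)]
    rw [hco, hmac]
    refine ⟨?_, fun h => ?_, fun h => ?_, fun h => ?_⟩
    · rw [VVMac.specGT_spectralVector_iff hq hs hqs, VVMac.specGT_spectralVector_iff hq hs hqs,
        VVMac.specNsim_spectralVector_iff hq hs hqs]
      by_cases hv : v i.castSucc = v i.succ
      · obtain ⟨k, hk, hk'⟩ := VVMac.exists_rankFun_eq hv
        have := T.content_sub_ne_zero k
        rw [hk, hk', abs_eq zero_le_one]
        omega
      · omega
    · obtain ⟨w, U, hwU, hP⟩ := VVMac.ybStep_canonPoly_of_specGT hq hs hqs h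
      rw [← hwU, hmac, hP]
      exact ⟨hwd U w, rfl⟩
    · -- the polynomial is reached by the arrow from the exchanged spectral vector
      obtain ⟨w, U, hwU⟩ := VVMac.exists_spectralVector_eq_vecSwap hq hs hqs h
      have h' : VVMac.SpecGT q s (VVMac.spectralVector q s w U i.succ)
          (VVMac.spectralVector q s w U i.castSucc) := by
        rwa [hwU, VVMac.vecSwap_castSucc, VVMac.vecSwap_succ]
      obtain ⟨w', U', hwU', hP⟩ := VVMac.ybStep_canonPoly_of_specGT hq hs hqs h'
      rw [hwU, VVMac.vecSwap_vecSwap] at hwU'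
      obtain ⟨rfl, rfl⟩ := VVMac.spectralVector_injective hq hs hqs hwU'
      have hsq := VVMac.ybStep_vecSwap_ybStep hs hs1 (i := i)
        (VVMac.spectralVector_ne_zero hq hs w U)
        (VVMac.spectralVector_castSucc_ne_succ hq hs hqs w U i) (VVMac.canonPoly q s U w)
      rw [hP, hwU, VVMac.vecSwap_vecSwap, VVMac.vecSwap_castSucc, VVMac.vecSwap_succ] at hsq
      rw [← hwU, hmac, hsq]
      refine ⟨hwd U w, ?_⟩
      congr 1
      rw [sub_sq_comm]
      congr 1
      ring
    · obtain ⟨hv, hc⟩ := (VVMac.specNsim_spectralVector_iff hq hs hqs v T _ _).1 h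
      obtain ⟨k, hk, hk'⟩ := VVMac.exists_rankFun_eq hv
      rw [hk, hk', abs_eq zero_le_one] at hc
      rw [(VVMac.stepsKnown hq hs hqs v T i).2 k hv hk, VVMac.exchangeCoeff,
        if_pos (by omega), zero_smul]
  · rw [hmac, ← VVMac.spectralVector_vecRotate, hmac, VVMac.canonPoly_vecRotate]
    exact ⟨hwd T _, rfl⟩
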